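/- **Proposition (Vanhove's operators in explicit form).** Let $m\ge 1$ be an integer. For an integer $k\ge 1$ let $A_{m,k}$ be the set of tuples $(\alpha_1,\dots,\alpha_k)$ of integers in $[1,m+1]$ with $\alpha_{n+1}\le\alpha_n-2$ for $1\le n<k$, and put $\alpha_{k+1}:=1$. Verrill's polynomials are $\mathscr V_{m,0}(t)=t^m$ and, for $k\ge 1$, $$\mathscr V_{m,k}(t)=t^m\sum_{\alpha\in A_{m,k}}\prod_{n=1}^k\alpha_n(\alpha_n-m-2)\Big(\frac{t-n}{t-n+1}\Big)^{\alpha_n-1}=\sum_{\alpha\in A_{m,k}}t^{m+1-\alpha_1}\prod_{n=1}^k\alpha_n(\alpha_n-m-2)(t-n)^{\alpha_n-\alpha_{n+1}}\in\mathbb Z[t]$$ (the two expressions agree as rational functions; empty sums are $0$). Write $D=d/du$ and $(\widehat\vartheta f)(u)=D[uf(u)]$. Vanhove's operator $\widetilde L_m=\sum_{j=0}^m\ell_{m,j}(u)D^j$, with $\ell_{m,j}\in\mathbb Z[u]$, is the operator with leading coefficient $$\ell_{m,m}(u)=u^{\lfloor (m+1)/2\rfloor}\prod_{\substack{1\le n\le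 m+1\\ n\equiv m+1\ (\mathrm{mod}\ 2)}}(u-n^2)$$ for which there is a constant $c\ne0$ such that $$c\,t\,\widetilde L_m I_0(\sqrt u\,t)=L_{m+2}^*\Big[\frac{I_0(\sqrt u\,t)}{t}\Big]\qquad(u,t>0),$$ where $\widetilde L_m$ acts on $u$, $I_0(x)=\frac1\pi\int_0^\pi e^{x\cos\varphi}\,d\varphi$, and $L_{m+2}^*$ is the formal adjoint with respect to $dt$ of the operator $L_{m+2}$ in $t$ (the $(m+1)$-st symmetric power of the Bessel operator, which annihilates $I_0(t)^aK_0(t)^b$ for $a+b=m+1$, where $K_0(t)=\int_0^\infty e^{-t\cosh x}\,dx$) given by $\theta=t\,\frac{d}{dt}$, $L_0=1$, $L_1=\theta$, $L_{k+1}=\theta L_k-k(m+2-k)t^2L_{k-1}$ for $1\le k\le m+1$. Then $\widetilde L_m$ exists, is unique, and has the explicit representation $$\widetilde L_m=(-1)^m\sum_{k=0}^{\lfloor m/2\rfloor+1}u^{1-k}\,\mathscr V_{m,k}(k-\widehat\vartheta).$$ This is an identity of differential operators: both sides take the same value at every $u\neq 0$ on every function that is $m$ times continuously differentiable near $u$.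 Here $u$ is real or complex, the derivatives are taken with respect to $u$ in the same sense, and the function has values in an arbitrary normed space over the respective field. -/

import Mathlib

open Polynomial

/-! ## Verrill's polynomials -/

/-- The index set of the Verrill sums: tuples `α = (α₁, …, α_k)` of integers in `[1, m + 1]` such
that `α_{n+1} ≤ α_n - 2` for all consecutive entries (`1 ≤ n < k`).  The entry `α_n` is stored at
position `n - 1` of `Fin k`. -/
def verrillTuples (m k : ℕ) : Finset (Fin k → ℕ) :=
  (Fintype.piFinset fun _ : Fin k => Finset.Icc 1 (m + 1)).filter
    fun α => ∀ i j : Fin k, (j : ℕ) = (i : ℕ) + 1 → α j + 2 ≤ α i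

/-- The entry `α_n` (numbered from `1` to `k`), with the convention `α_{k+1} = 1`. -/
def verrillEntry {k : ℕ} (α : Fin k → ℕ) (n : ℕ) : ℕ :=
  if h : 1 ≤ n ∧ n ≤ k then α ⟨n - 1, by omega⟩ else 1

/-- Verrill's polynomials `𝒱_{m,k}(t) ∈ ℤ[t]`, normalized by `𝒱_{m,0}(t) = t ^ m`.  All the
exponents are differences `a - b` with `b ≤ a` on the index set. -/
noncomputable def verrillPoly (m k : ℕ) : ℤ[X] :=
  if k = 0 then X ^ m
  else
    ∑ α ∈ verrillTuples m k,
      X ^ (m + 1 - verrillEntry α 1) *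
        ∏ n ∈ Finset.Icc 1 k,
          (C ((verrillEntry α n : ℤ) * ((verrillEntry α n : ℤ) - (m : ℤ) - 2)) *
            (X - C (n : ℤ)) ^ (verrillEntry α n - verrillEntry α (n + 1)))

/-- The other expression for Verrill's polynomials, `t ^ m` times a sum of products of powers of
`(t - n) / (t - n + 1)`, as a rational function of `t`. -/
noncomputable def verrillRat (m k : ℕ) : RatFunc ℚ :=
  RatFunc.X ^ m *
    ∑ α ∈ verrillTuples m k,
      ∏ n ∈ Finset.Icc 1 k,
        (((verrillEntry α n : RatFunc ℚ) * ((verrillEntry α n : RatFunc ℚ) - (m : RatFunc ℚ) - 2)) *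
          ((RatFunc.X - (n : RatFunc ℚ)) / (RatFunc.X - (n : RatFunc ℚ) + 1)) ^
            (verrillEntry α n - 1))

/-! ## Differential operators in the variable `u` -/

/-- The differential operator `∑_{j=0}^m ℓ_j(u) D^j` with coefficients `ℓ_j ∈ ℤ[u]`, applied to
`f` at the point `u`. -/
noncomputable def polyDiffOp {𝕜 E : Type*} [RCLike 𝕜] [NormedAddCommGroup E] [NormedSpace 𝕜 E]
    {m : ℕ} (l : Fin (m + 1) → ℤ[X]) (f : 𝕜 → E) (u : 𝕜) : E :=
  ∑ j : Fin (m + 1), aeval u (l j) • iteratedDeriv (j : ℕ) f u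

/-- The operator `ϑ̂`, given by `(ϑ̂ f)(u) = D[u f(u)]`. -/
noncomputable def thetaHat {𝕜 E : Type*} [RCLike 𝕜] [NormedAddCommGroup E] [NormedSpace 𝕜 E]
    (f : 𝕜 → E) : 𝕜 → E :=
  fun u => deriv (fun v => v • f v) u

/-- The operator `p(ϑ̂) = ∑ᵢ pᵢ ϑ̂ⁱ`, for a polynomial `p = ∑ᵢ pᵢ Xⁱ` with integer coefficients,
applied to `f` at the point `u`. -/
noncomputable def polyThetaHat {𝕜 E : Type*} [RCLike 𝕜] [NormedAddCommGroup E] [NormedSpace 𝕜 E]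
    (p : ℤ[X]) (f : 𝕜 → E) (u : 𝕜) : E :=
  p.sum fun i c => c • (thetaHat^[i] f) u

/-! ## Vanhove's operators -/

/-- The modified Bessel function `I₀(x) = (1/π) ∫_0^π exp(x cos φ) dφ`. -/
noncomputable def besselI0 (x : ℝ) : ℝ :=
  Real.pi⁻¹ * ∫ φ in (0 : ℝ)..Real.pi, Real.exp (x * Real.cos φ)

/-- The formal adjoints `L_k^*` (with respect to `dt`) of the Bessel-power operators `L_k` in the
variable `t`.  With `θ = t d/dt`, the latter are given by the Bronstein--Mulders--Weil and
Borwein--Salvy recursion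
`L₀ = 1`, `L₁ = θ`, `L_{k+1} = θ L_k - k (N + 1 - k) t² L_{k-1}`,
and `L_{N+1}` is the `N`-th symmetric power of the Bessel operator `θ² - t²`: it has order `N + 1`
and annihilates the products `I₀(t)^a K₀(t)^b` with `a + b = N`.  By the rules
`(A B)^* = B^* A^*`, `θ^* g = -(t g)'` and `(t²)^* = t²`, the adjoints satisfy
`L₀^* = 1`, `L₁^* = θ^*`, `L_{k+1}^* = L_k^* θ^* - k (N + 1 - k) L_{k-1}^* t²`. -/
noncomputable def besselPowOpAdj (N : ℕ) : ℕ → (ℝ → ℝ) → (ℝ → ℝ)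
  | 0 => fun g => g
  | 1 => fun g t => -deriv (fun s => s * g s) t
  | k + 2 => fun g t =>
      besselPowOpAdj N (k + 1) (fun s => -deriv (fun r => r * g r) s) t -
        ((k : ℝ) + 1) * ((N : ℝ) - (k : ℝ)) * besselPowOpAdj N k (fun s => s ^ 2 * g s) t

/-- `∑_{j=0}^m ℓ_j(u) D^j`, with `ℓ_j ∈ ℤ[u]`, is Vanhove's operator `L̃_m`.

* Its leading coefficient is `u^⌊(m+1)/2⌋ ∏ (u - n²)`, over `1 ≤ n ≤ m + 1` with `n ≡ m + 1 mod 2`,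
  which is `u^k ∏_{j=1}^k (u - (2j)²)` for `m = 2k - 1`
  and `u^k ∏_{j=1}^{k+1} (u - (2j-1)²)` for `m = 2k`.
* Up to a nonzero constant factor (fixed by the leading coefficient), it is the operator in `u`
  that is obtained by transferring the operator `L_{m+2}` of the `(m+1)`-st Bessel powers from
  these powers to the kernel `I₀(√u t)` through integration by parts, that is
  `c t L̃_m I₀(√u t) = L_{m+2}^* [I₀(√u t) / t]`, with `L̃_m` acting on `u` and `L_{m+2}^*` on `t`.
  (Pairing with `I₀(t)^a K₀(t)^b`, `a + b = m + 1`, this is the differential equation in `u` of the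
  Bessel moments `∫ I₀(√u t) I₀(t)^a K₀(t)^b t dt`.) -/
def IsVanhoveOperator (m : ℕ) (l : Fin (m + 1) → ℤ[X]) : Prop :=
  l (Fin.last m) =
      X ^ ((m + 1) / 2) *
        ∏ n ∈ (Finset.Icc 1 (m + 1)).filter (fun n => n % 2 = (m + 1) % 2),
          (X - C ((n : ℤ) ^ 2)) ∧
  ∃ c : ℝ, c ≠ 0 ∧ ∀ u : ℝ, 0 < u → ∀ t : ℝ, 0 < t →
    c * (t * polyDiffOp l (fun v : ℝ => besselI0 (Real.sqrt v * t)) u) =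
      besselPowOpAdj (m + 1) (m + 2) (fun s => besselI0 (Real.sqrt u * s) / s) t

/-!
Both sides of the transfer identity are power series in `t ^ 2`, and the proof compares their
coefficients.

With `I₀(√u t) = ∑ n, (u / 4) ^ n / n!² * t ^ (2 n)` (`besselI0_sqrt_mul`), the adjoint `L_{m+2}^*`
acts on coefficients, and unfolding its three-term recursion gives a sum over all ways to descend
from `m + 2` to `0` by single steps (factors `-θ`) and double steps (factors `t ^ 2`)
(`descentSum`, `besselSeqOp_eq_sum`). The positions of the double steps form a sparse tuple
`α₁ > α₂ > ⋯`, and so the descents with `k` double steps sum up, except for a power of `2`, to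
`𝒱_{m,k}` divided by the squares `(t - 1)² ⋯ (t - k + 1)²` (`sum_tupleTerm`). These squares are the
quotients of the coefficients `1 / n!²` of `I₀`, so the transferred operator takes `u ^ n` to a
multiple of `∑ k, 𝒱_{m,k}(k - n - 1) u ^ (n + 1 - k)`, where the factor depends only on `m`. Since
`ϑ̂ u ^ n = (n + 1) u ^ n`, this is the asserted
explicit operator, with the constant `c = (-2) ^ m` (`isVanhoveOperator_vanhoveCoeff`).

The explicit operator has coefficients in `ℤ[u]`: the powers of `ϑ̂` expand into `u ^ j D ^ j` with
Stirling numbers as coefficients, and `𝒱_{m,k}(k - n - 1)` vanishes for `n < k - 1`, which removes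
the terms with `j < k - 1` and hence the negative powers of `u` (`thetaCoeff_eq_zero`).

Its leading coefficient is `∑ k, v_k u ^ (m + 1 - k)`, where `v_k` is the leading coefficient of
`𝒱_{m,k}`. Up to a substitution this is the characteristic polynomial of the Sylvester-Kac matrix of
size `m + 2`, whose eigenvalues are `m + 1, m - 1, …, -(m + 1)`: for the value `m + 1 - 2 i`, the
continuants are `K!` times the coefficients of `(1 + X) ^ (m + 1 - i) * (1 - X) ^ i`, a polynomial
of degree `m + 1`, so that the continuant of index `m + 2` vanishes (`sum_descentSum_eq_zero`).

Uniqueness holds because the derivatives of `I₀(√u t)` with respect to `u` are linearly independent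
functions of `t` (`aeval_eq_of_polyDiffOp_besselI0`); the leading coefficient fixes the constant.
-/

/-! ### Sums over sparse tuples -/

/-- The sum over all ways to descend from `K` to `0` by single steps and by exactly `j` double
steps. A single step taken after `i` double steps has weight `x i`, and a double step from `n + 1`
to `n - 1` has weight `w n`. -/
def descentSum {R : Type*} [CommRing R] (w : ℕ → R) : ℕ → ℕ → (ℕ → R) → R
  | 0, 0, _ => 1
  | 0, _ + 1, _ => 0
  | 1, 0, x => x 0
  | 1, _ + 1, _ => 0
  | K + 2, 0, x => x 0 * descentSum w (K + 1) 0 x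
  | K + 2, j + 1, x =>
      x 0 * descentSum w (K + 1) (j + 1) x + w (K + 1) * descentSum w K j (fun n => x (n + 1))

section DescentSum

variable {R : Type*} [CommRing R] (w : ℕ → R)

theorem descentSum_zero_right (K : ℕ) (x : ℕ → R) : descentSum w K 0 x = x 0 ^ K := by
  induction K using Nat.twoStepInduction with
  | zero => simp [descentSum]
  | one => simp [descentSum]
  | more K _ ih => rw [descentSum, ih]; ring

theorem descentSum_eq_zero (K : ℕ) : ∀ (j : ℕ) (x : ℕ → R), K < 2 * j →
    descentSum w K j x = 0 := by
  induction K using Nat.twoStepInduction with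
  | zero => rintro (_ | j) x h <;> simp [descentSum] at *
  | one => rintro (_ | j) x h <;> simp [descentSum] at *
  | more K ih1 ih2 =>
    rintro (_ | j) x h
    · simp at h
    · rw [descentSum, ih2 _ _ (by omega), ih1 _ _ (by omega)]; ring

theorem descentSum_smul (c : R) (K : ℕ) : ∀ (j : ℕ) (x : ℕ → R),
    c ^ (2 * j) * descentSum w K j (fun n => c * x n) = c ^ K * descentSum w K j x := by
  induction K using Nat.twoStepInduction with
  | zero => rintro (_ | j) x <;> simp [descentSum]
  | one => rintro (_ | j) x <;> simp [descentSum]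
  | more K ih1 ih2 =>
    rintro (_ | j) x
    · simp only [descentSum_zero_right]; ring
    · rw [descentSum, descentSum]
      have h1 := ih1 j (fun n => x (n + 1))
      have h2 := ih2 (j + 1) x
      linear_combination c * x 0 * h2 + c ^ 2 * w (K + 1) * h1

theorem map_descentSum {S : Type*} [CommRing S] (φ : R →+* S) (K : ℕ) : ∀ (j : ℕ) (x : ℕ → R),
    φ (descentSum w K j x) = descentSum (fun n => φ (w n)) K j (fun n => φ (x n)) := by
  induction K using Nat.twoStepInduction with
  | zero => rintro (_ | j) x <;> simp [descentSum]
  | one => rintro (_ | j) x <;> simp [descentSum]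
  | more K ih1 ih2 => rintro (_ | j) x <;> simp [descentSum, ih1, ih2]

end DescentSum

/-- Tuples with entries in `[1, B]` in which each entry exceeds the next one by at least `2`. -/
def sparseTuples (B k : ℕ) : Finset (Fin k → ℕ) :=
  (Fintype.piFinset fun _ : Fin k => Finset.Icc 1 B).filter
    fun α => ∀ i j : Fin k, (j : ℕ) = (i : ℕ) + 1 → α j + 2 ≤ α i

theorem mem_sparseTuples {B k : ℕ} {α : Fin k → ℕ} : α ∈ sparseTuples B k ↔
    (∀ i, 1 ≤ α i ∧ α i ≤ B) ∧ ∀ i j : Fin k, (j : ℕ) = (i : ℕ) + 1 → α j + 2 ≤ α i := by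
  simp [sparseTuples]

theorem le_first_of_sparse {k : ℕ} {α : Fin (k + 1) → ℕ}
    (h : ∀ i j : Fin (k + 1), (j : ℕ) = (i : ℕ) + 1 → α j + 2 ≤ α i) (i : Fin (k + 1)) :
    α i ≤ α 0 := by
  obtain ⟨n, hn⟩ := i
  induction n with
  | zero => rfl
  | succ n ih => have := h ⟨n, by omega⟩ ⟨n + 1, hn⟩ rfl; have := ih (by omega); omega

theorem cons_mem_sparseTuples {B k : ℕ} {β : Fin k → ℕ} :
    (Fin.cons (B + 1) β : Fin (k + 1) → ℕ) ∈ sparseTuples (B + 1) (k + 1) ↔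
      β ∈ sparseTuples (B - 1) k := by
  rw [mem_sparseTuples, mem_sparseTuples]
  constructor
  · rintro ⟨h1, h2⟩
    have h3 : ∀ i j : Fin k, (j : ℕ) = (i : ℕ) + 1 → β j + 2 ≤ β i := fun i j hij => by
      simpa using h2 i.succ j.succ (by simp [hij])
    refine ⟨fun i => ⟨by simpa using (h1 i.succ).1, ?_⟩, h3⟩
    cases k with
    | zero => exact i.elim0
    | succ k =>
      have := le_first_of_sparse h3 i
      have h4 := h2 0 (Fin.succ 0) (by simp)
      simp only [Fin.cons_succ, Fin.cons_zero] at h4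
      omega
  · rintro ⟨h1, h2⟩
    refine ⟨fun i => ?_, fun i j hij => ?_⟩
    · induction i using Fin.cases with
      | zero => simp
      | succ i => have := h1 i; simp only [Fin.cons_succ]; omega
    · induction j using Fin.cases with
      | zero => simp at hij
      | succ j =>
        induction i using Fin.cases with
        | zero => have := h1 j; simp only [Fin.cons_succ, Fin.cons_zero]; omega
        | succ i => simpa using h2 i j (by simpa using hij)

theorem sparseTuples_zero_succ (k : ℕ) : sparseTuples 0 (k + 1) = ∅ := by
  refine Finset.eq_empty_of_forall_notMem fun α hα => ?_
  have := (mem_sparseTuples.1 hα).1 0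
  omega

theorem sparseTuples_zero_right (B : ℕ) : sparseTuples B 0 = {Fin.elim0} := by
  ext α
  simp [mem_sparseTuples, Subsingleton.elim α Fin.elim0]

/-- A sparse tuple with entries at most `B + 1` either has entries at most `B`, or starts with
`B + 1` and goes on with entries at most `B - 1`. -/
theorem sum_sparseTuples_succ {M : Type*} [AddCommMonoid M] (B k : ℕ)
    (f : (Fin (k + 1) → ℕ) → M) :
    ∑ α ∈ sparseTuples (B + 1) (k + 1), f α =
      ∑ α ∈ sparseTuples B (k + 1), f α +
        ∑ β ∈ sparseTuples (B - 1) k, f (Fin.cons (B + 1) β) := by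
  rw [← Finset.sum_filter_not_add_sum_filter _ (fun α => α 0 = B + 1)]
  congr 1
  · refine Finset.sum_congr ?_ fun _ _ => rfl
    ext α
    simp only [Finset.mem_filter, mem_sparseTuples]
    constructor
    · rintro ⟨⟨h1, h2⟩, h3⟩
      refine ⟨fun i => ⟨(h1 i).1, ?_⟩, h2⟩
      have := le_first_of_sparse h2 i
      have := h1 0
      omega
    · rintro ⟨h1, h2⟩
      exact ⟨⟨fun i => ⟨(h1 i).1, by have := h1 i; omega⟩, h2⟩, by have := h1 0; omega⟩
  · symm
    refine Finset.sum_bij (fun β _ => (Fin.cons (B + 1) β : Fin (k + 1) → ℕ)) ?_ ?_ ?_ ?_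
    · intro β hβ
      exact Finset.mem_filter.2 ⟨cons_mem_sparseTuples.2 hβ, rfl⟩
    · intro β _ β' _ h
      exact (Fin.cons_injective2 h).2
    · intro α hα
      obtain ⟨h1, h2⟩ := Finset.mem_filter.1 hα
      have h3 : (Fin.cons (B + 1) (Fin.tail α) : Fin (k + 1) → ℕ) = α := by
        rw [← h2]; exact Fin.cons_self_tail α
      exact ⟨Fin.tail α, cons_mem_sparseTuples.1 (h3 ▸ h1), h3⟩
    · intros; rfl

theorem verrillEntry_cons_one {k : ℕ} (a : ℕ) (β : Fin k → ℕ) :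
    verrillEntry (Fin.cons a β : Fin (k + 1) → ℕ) 1 = a := by
  simp [verrillEntry]

theorem verrillEntry_cons {k : ℕ} (a : ℕ) (β : Fin k → ℕ) (n : ℕ) (hn : 1 ≤ n) :
    verrillEntry (Fin.cons a β : Fin (k + 1) → ℕ) (n + 1) = verrillEntry β n := by
  obtain ⟨n, rfl⟩ := Nat.exists_eq_add_of_le' hn
  unfold verrillEntry
  by_cases h : n + 1 ≤ k
  · rw [dif_pos (by omega), dif_pos (by omega)]
    exact Fin.cons_succ (α := fun _ => ℕ) a β ⟨n, by omega⟩
  · rw [dif_neg (by omega), dif_neg (by omega)]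

theorem prod_Icc_one_succ {M : Type*} [CommMonoid M] (f : ℕ → M) (k : ℕ) :
    ∏ n ∈ Finset.Icc 1 (k + 1), f n = f 1 * ∏ n ∈ Finset.Icc 1 k, f (n + 1) := by
  rw [← Finset.insert_Icc_add_one_left_eq_Icc (by omega), Finset.prod_insert (by simp),
    ← Finset.image_add_right_Icc, Finset.prod_image (by simp)]

/-- The contribution of the tuple `α` to a Verrill sum, with the variables `t - n` replaced by
arbitrary elements `x n` of a ring. -/
def tupleTerm {R : Type*} [CommRing R] (w : ℕ → R) (B k : ℕ) (α : Fin k → ℕ) (x : ℕ → R) : R :=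
  x 0 ^ (B - verrillEntry α 1) *
    ∏ n ∈ Finset.Icc 1 k,
      (w (verrillEntry α n) * x n ^ (verrillEntry α n - verrillEntry α (n + 1)))

section TupleTerm

variable {R : Type*} [CommRing R] (w : ℕ → R)

theorem tupleTerm_cons (B k : ℕ) (β : Fin k → ℕ) (x : ℕ → R) :
    tupleTerm w B (k + 1) (Fin.cons B β) x = w B * tupleTerm w B k β (fun n => x (n + 1)) := by
  rw [tupleTerm, prod_Icc_one_succ,
    verrillEntry_cons_one, verrillEntry_cons _ _ 1 le_rfl, tupleTerm, Nat.sub_self, pow_zero,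
    one_mul, mul_assoc]
  congr 2
  refine Finset.prod_congr rfl fun n hn => ?_
  rw [Finset.mem_Icc] at hn
  rw [verrillEntry_cons _ _ n hn.1, verrillEntry_cons _ _ (n + 1) (by omega)]

theorem verrillEntry_one_le {B k : ℕ} {α : Fin (k + 1) → ℕ} (hα : α ∈ sparseTuples B (k + 1)) :
    verrillEntry α 1 ≤ B := by
  have := (mem_sparseTuples.1 hα).1 0
  simpa [verrillEntry] using this.2

/-- Enlarging the bound by `d` multiplies the contribution by `x 0 ^ d`. -/
theorem tupleTerm_add (B d k : ℕ) (α : Fin k → ℕ) (x : ℕ → R) (h : verrillEntry α 1 ≤ B) :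
    tupleTerm w (B + d) k α x = x 0 ^ d * tupleTerm w B k α x := by
  rw [tupleTerm, tupleTerm, Nat.sub_add_comm h]; ring

/-- Verrill sums in terms of the descent sums. A double step of a descent skips two of the factors
of a Verrill sum, whence the squares. -/
theorem sum_tupleTerm (B : ℕ) : ∀ (k : ℕ) (x : ℕ → R),
    ∑ α ∈ sparseTuples B (k + 1), tupleTerm w B (k + 1) α x =
      descentSum w (B + 1) (k + 1) x * ∏ i ∈ Finset.Icc 1 k, x i ^ 2 := by
  induction B using Nat.twoStepInduction with
  | zero => intro k x; simp [sparseTuples_zero_succ, descentSum]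
  | one =>
    intro k x
    rw [sum_sparseTuples_succ, sparseTuples_zero_succ]
    cases k with
    | zero =>
      simp [sparseTuples_zero_right, tupleTerm_cons, descentSum]
      simp [tupleTerm, verrillEntry]
    | succ k => simp [sparseTuples_zero_succ, descentSum]
  | more B ih1 ih2 =>
    intro k x
    rw [sum_sparseTuples_succ, descentSum, add_mul, mul_assoc, ← ih2, Finset.mul_sum]
    congr 1
    · exact Finset.sum_congr rfl fun α hα => by
        rw [tupleTerm_add w (B + 1) 1 _ _ _ (verrillEntry_one_le hα), pow_one]
    · simp only [tupleTerm_cons, ← Finset.mul_sum]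
      rw [mul_assoc]
      congr 1
      cases k with
      | zero =>
        simp [sparseTuples_zero_right, descentSum_zero_right]
        simp [tupleTerm, verrillEntry]
      | succ k =>
        rw [prod_Icc_one_succ, mul_left_comm, ← ih1, Finset.mul_sum]
        refine Finset.sum_congr rfl fun α hα => ?_
        exact tupleTerm_add w B 2 _ _ _ (verrillEntry_one_le hα)

end TupleTerm

/-! ### Verrill's polynomials -/

/-- The weight `n (n - m - 2)` in Verrill's polynomials. -/
def verrillWeight (R : Type*) [CommRing R] (m n : ℕ) : R := (n : R) * ((n : R) - (m : R) - 2)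

theorem map_verrillWeight {R S : Type*} [CommRing R] [CommRing S] (φ : R →+* S) (m n : ℕ) :
    φ (verrillWeight R m n) = verrillWeight S m n := by
  simp [verrillWeight, map_ofNat φ 2]

theorem verrillPoly_succ (m k : ℕ) : verrillPoly m (k + 1) =
    ∑ α ∈ sparseTuples (m + 1) (k + 1),
      tupleTerm (verrillWeight ℤ[X] m) (m + 1) (k + 1) α (fun n => X - C (n : ℤ)) := by
  simp [verrillPoly, tupleTerm, verrillTuples, sparseTuples, verrillWeight]

theorem verrillPoly_eq_descentSum (m k : ℕ) : verrillPoly m (k + 1) =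
    descentSum (verrillWeight ℤ[X] m) (m + 2) (k + 1) (fun n => X - C (n : ℤ)) *
      ∏ i ∈ Finset.Icc 1 k, (X - C (i : ℤ)) ^ 2 := by
  rw [verrillPoly_succ, sum_tupleTerm]

theorem eval_verrillPoly (m k : ℕ) (t : ℤ) : (verrillPoly m (k + 1)).eval t =
    descentSum (verrillWeight ℤ m) (m + 2) (k + 1) (fun n => t - n) *
      ∏ i ∈ Finset.Icc 1 k, (t - i) ^ 2 := by
  rw [verrillPoly_eq_descentSum, ← coe_evalRingHom, map_mul, map_descentSum, map_prod]
  simp [map_verrillWeight]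

/-- Each factor of a descent sum is monic of degree one, so that the coefficient of the highest
possible degree is the descent sum with `x = 1`. Multiplication by `X ^ (2 * j)` makes the degree
independent of `j`. -/
theorem descentSum_leading (w : ℕ → ℤ) (K : ℕ) : ∀ (j : ℕ) (y : ℕ → ℤ),
    (descentSum (fun n => C (w n)) K j (fun n => X - C (y n)) * X ^ (2 * j)).natDegree ≤ K ∧
      (descentSum (fun n => C (w n)) K j (fun n => X - C (y n)) * X ^ (2 * j)).coeff K =
        descentSum w K j (fun _ => 1) := by
  induction K using Nat.twoStepInduction with
  | zero => rintro (_ | j) y <;> simp [descentSum]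
  | one =>
    rintro (_ | j) y
    · simp [descentSum, -eq_intCast]
    · simp [descentSum]
  | more K ih1 ih2 =>
    have key : ∀ (p q : ℤ[X]) (a b c : ℤ), p.natDegree ≤ K + 1 → q.natDegree ≤ K →
        ((X - C a) * p + C b * (X ^ 2 * q)).natDegree ≤ K + 2 ∧
        ((X - C a) * p + C b * (X ^ 2 * q)).coeff (K + 2) =
          p.coeff (K + 1) + b * q.coeff K := by
      intro p q a b c hp hq
      have h1 : (X - C a).natDegree ≤ 1 := natDegree_X_sub_C_le a
      have h2 : (X ^ 2 : ℤ[X]).natDegree ≤ 2 := natDegree_X_pow_le 2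
      constructor
      · refine natDegree_add_le_of_degree_le ?_ ((natDegree_C_mul_le _ _).trans ?_)
        · exact (natDegree_mul_le_of_le h1 hp).trans (by omega)
        · exact (natDegree_mul_le_of_le h2 hq).trans (by omega)
      · have h3 := coeff_mul_add_eq_of_natDegree_le h1 hp
        have h4 := coeff_mul_add_eq_of_natDegree_le h2 hq
        rw [show 1 + (K + 1) = K + 2 by omega] at h3
        rw [show 2 + K = K + 2 by omega] at h4
        rw [coeff_add, coeff_C_mul, h3, h4]
        simp [-eq_intCast]
    rintro (_ | j) y
    · have h := key _ 0 (y 0) 0 0 (ih2 0 y).1 (by simp)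
      have h2 := (ih2 0 y).2
      simp only [descentSum_zero_right, mul_zero, pow_zero, mul_one, add_zero, zero_mul] at h h2 ⊢
      rw [pow_succ' _ (K + 1)]
      exact ⟨h.1, by rw [h.2, h2]; simp⟩
    · have h := key _ _ (y 0) (w (K + 1)) 0 (ih2 (j + 1) y).1 (ih1 j (fun n => y (n + 1))).1
      rw [(ih2 (j + 1) y).2, (ih1 j _).2] at h
      have h3 : ∀ p q a b : ℤ[X], (a * p + b * q) * X ^ (2 * (j + 1)) =
        a * (p * X ^ (2 * (j + 1))) + b * (X ^ 2 * (q * X ^ (2 * j))) := fun p q a b => by ring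
      rw [descentSum, descentSum, h3, one_mul]
      exact h

theorem verrillPoly_leading (m k : ℕ) : (verrillPoly m k).natDegree ≤ m ∧
    (verrillPoly m k).coeff m = descentSum (verrillWeight ℤ m) (m + 2) k (fun _ => 1) := by
  cases k with
  | zero => simp [verrillPoly, descentSum_zero_right]
  | succ k =>
    obtain ⟨h1, h2⟩ := descentSum_leading (verrillWeight ℤ m) (m + 2) (k + 1) (fun n => (n : ℤ))
    set q := descentSum (fun n => C (verrillWeight ℤ m n)) (m + 2) (k + 1)
      (fun n => X - C (n : ℤ)) * X ^ (2 * (k + 1)) with hq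
    have h3 : (∏ i ∈ Finset.Icc 1 k, (X - C (i : ℤ)) ^ 2 : ℤ[X]).Monic :=
      monic_prod_of_monic _ _ fun i _ => (monic_X_sub_C _).pow 2
    have h4 : (∏ i ∈ Finset.Icc 1 k, (X - C (i : ℤ)) ^ 2 : ℤ[X]).natDegree = 2 * k := by
      rw [natDegree_prod_of_monic _ _ fun i _ => (monic_X_sub_C _).pow 2]
      rw [Finset.sum_congr rfl fun i _ => by rw [natDegree_pow, natDegree_X_sub_C]]
      simp [mul_comm]
    have h5 : verrillPoly m (k + 1) * X ^ (2 * (k + 1)) =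
        q * ∏ i ∈ Finset.Icc 1 k, (X - C (i : ℤ)) ^ 2 := by
      rw [verrillPoly_eq_descentSum, hq]
      have : verrillWeight ℤ[X] m = fun n => C (verrillWeight ℤ m n) :=
        funext fun n => (map_verrillWeight C m n).symm
      rw [this]; ring
    have h6 : ∀ d, (verrillPoly m (k + 1)).coeff d =
        (q * ∏ i ∈ Finset.Icc 1 k, (X - C (i : ℤ)) ^ 2).coeff (d + 2 * (k + 1)) := fun d => by
      rw [← h5, coeff_mul_X_pow]
    constructor
    · rw [natDegree_le_iff_coeff_eq_zero]
      intro d hd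
      rw [h6]
      refine coeff_eq_zero_of_natDegree_lt ((natDegree_mul_le_of_le h1 h4.le).trans_lt ?_)
      omega
    · rw [h6, show m + 2 * (k + 1) = (m + 2) + 2 * k by omega,
        coeff_mul_add_eq_of_natDegree_le h1 h4.le, h2, ← h4, h3.coeff_natDegree, mul_one]

/-- The step from one expression for Verrill's polynomials to the other; the power of `x k` on the
right-hand side is what makes the induction on `k` work, and it disappears for `e (k + 1) = 0`. -/
theorem prod_div_pow_telescope {F : Type*} [Field F] (x : ℕ → F) (hx : ∀ n, x n ≠ 0) (e : ℕ → ℕ)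
    (k : ℕ) (he : ∀ n, 1 ≤ n → n ≤ k → e (n + 1) ≤ e n) :
    x 0 ^ e 1 * ∏ n ∈ Finset.Icc 1 k, (x n / x (n - 1)) ^ e n =
      x k ^ e (k + 1) * ∏ n ∈ Finset.Icc 1 k, x n ^ (e n - e (n + 1)) := by
  induction k with
  | zero => simp
  | succ k ih =>
    rw [Finset.prod_Icc_succ_top (by omega), Finset.prod_Icc_succ_top (by omega), ← mul_assoc,
      ih fun n h1 h2 => he n h1 (by omega)]
    have h1 : x (k + 1) ^ e (k + 1) =
        x (k + 1) ^ e (k + 1 + 1) * x (k + 1) ^ (e (k + 1) - e (k + 1 + 1)) := by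
      rw [← pow_add, Nat.add_sub_cancel' (he (k + 1) (by omega) le_rfl)]
    rw [Nat.add_sub_cancel, div_pow, h1]
    have := pow_ne_zero (e (k + 1)) (hx k)
    field_simp

theorem verrillEntry_succ_le {B k : ℕ} {α : Fin k → ℕ} (hα : α ∈ sparseTuples B k) {n : ℕ}
    (h1 : 1 ≤ n) (h2 : n ≤ k) : verrillEntry α (n + 1) ≤ verrillEntry α n := by
  obtain ⟨h3, h4⟩ := mem_sparseTuples.1 hα
  unfold verrillEntry
  rw [dif_pos (c := 1 ≤ n ∧ n ≤ k) ⟨h1, h2⟩]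
  split_ifs with h
  · have := h4 ⟨n - 1, by omega⟩ ⟨n + 1 - 1, by omega⟩ (by simp; omega)
    omega
  · exact (h3 _).1

theorem one_le_verrillEntry {B k : ℕ} {α : Fin k → ℕ} (hα : α ∈ sparseTuples B k) (n : ℕ) :
    1 ≤ verrillEntry α n := by
  unfold verrillEntry
  split_ifs with h
  · exact ((mem_sparseTuples.1 hα).1 _).1
  · rfl

theorem tupleTerm_eq_rat {F : Type*} [Field F] (w : ℕ → F) (m k : ℕ) {α : Fin (k + 1) → ℕ}
    (hα : α ∈ sparseTuples (m + 1) (k + 1)) (x : ℕ → F) (hx : ∀ n, x n ≠ 0) :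
    tupleTerm w (m + 1) (k + 1) α x =
      x 0 ^ m * ∏ n ∈ Finset.Icc 1 (k + 1),
        (w (verrillEntry α n) * (x n / x (n - 1)) ^ (verrillEntry α n - 1)) := by
  have h1 := verrillEntry_one_le hα
  have h2 := one_le_verrillEntry hα 1
  have h3 := prod_div_pow_telescope x hx (fun n => verrillEntry α n - 1) (k + 1)
    fun n h h' => Nat.sub_le_sub_right (verrillEntry_succ_le hα h h') 1
  have h4 : verrillEntry α (k + 1 + 1) = 1 := by simp [verrillEntry]
  simp only [h4, Nat.sub_self, pow_zero, one_mul] at h3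
  have h5 : ∏ n ∈ Finset.Icc 1 (k + 1), x n ^ (verrillEntry α n - 1 - (verrillEntry α (n + 1) - 1)) =
      ∏ n ∈ Finset.Icc 1 (k + 1), x n ^ (verrillEntry α n - verrillEntry α (n + 1)) :=
    Finset.prod_congr rfl fun n _ => by
      have := one_le_verrillEntry hα (n + 1)
      rw [Nat.sub_sub, Nat.add_sub_cancel' this]
  rw [tupleTerm, Finset.prod_mul_distrib, Finset.prod_mul_distrib, ← h5, ← h3,
    show m = (m + 1 - verrillEntry α 1) + (verrillEntry α 1 - 1) by omega, pow_add]
  rw [show m + 1 - verrillEntry α 1 + (verrillEntry α 1 - 1) + 1 - verrillEntry α 1 =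
    m + 1 - verrillEntry α 1 by omega]
  ring

theorem verrillPoly_eq_verrillRat (m k : ℕ) (hk : 0 < k) :
    algebraMap ℚ[X] (RatFunc ℚ) ((verrillPoly m k).map (Int.castRingHom ℚ)) = verrillRat m k := by
  obtain ⟨k, rfl⟩ := Nat.exists_eq_add_of_le' hk
  have hx : ∀ n : ℕ, (RatFunc.X - (n : RatFunc ℚ)) ≠ 0 := fun n => by
    have : (RatFunc.X - (n : RatFunc ℚ)) = algebraMap ℚ[X] (RatFunc ℚ) (X - C (n : ℚ)) := by simp
    rw [this]
    exact RatFunc.algebraMap_ne_zero (X_sub_C_ne_zero _)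
  rw [verrillPoly_succ, verrillRat, ← coe_mapRingHom, map_sum, map_sum, Finset.mul_sum]
  refine Finset.sum_congr rfl fun α hα => ?_
  have h := tupleTerm_eq_rat (verrillWeight (RatFunc ℚ) m) m k hα _ hx
  have h2 : ∀ n ∈ Finset.Icc 1 (k + 1), ((n - 1 : ℕ) : RatFunc ℚ) = n - 1 := fun n hn => by
    rw [Nat.cast_sub (Finset.mem_Icc.1 hn).1, Nat.cast_one]
  calc _ = tupleTerm (verrillWeight (RatFunc ℚ) m) (m + 1) (k + 1) α
        (fun n => RatFunc.X - (n : RatFunc ℚ)) := by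
        simp [tupleTerm, verrillWeight, Polynomial.map_prod, map_ofNat (algebraMap ℚ[X] _) 2]
    _ = _ := by
        rw [h]
        simp only [Nat.cast_zero, sub_zero]
        congr 1
        refine Finset.prod_congr rfl fun n hn => ?_
        rw [h2 n hn, verrillWeight, sub_sub_eq_add_sub, sub_add_eq_add_sub]

/-! ### The characteristic polynomial of the Sylvester-Kac matrix -/

theorem one_add_X_mul_derivative_pow (s : ℚ) (a : ℕ) :
    (1 + C s * X) * derivative ((1 + C s * X) ^ a) = C (s * a) * (1 + C s * X) ^ a := by
  cases a with
  | zero => simp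
  | succ a => simp [derivative_pow]; ring

/-- The numbers `K! g_K`, where `g_K` are the coefficients of `(1 + X) ^ a * (1 - X) ^ b`, satisfy
the three-term recursion of the continuants of the Sylvester-Kac matrix. -/
theorem coeff_one_add_mul_one_sub (a b K : ℕ) :
    ((K : ℚ) + 2) * ((1 + C 1 * X) ^ a * (1 + C (-1) * X) ^ b : ℚ[X]).coeff (K + 2) =
      ((a : ℚ) - b) * ((1 + C 1 * X) ^ a * (1 + C (-1) * X) ^ b : ℚ[X]).coeff (K + 1) -
        ((a : ℚ) + b - K) * ((1 + C 1 * X) ^ a * (1 + C (-1) * X) ^ b : ℚ[X]).coeff K := by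
  set G : ℚ[X] := (1 + C 1 * X) ^ a * (1 + C (-1) * X) ^ b with hG
  have h1 : derivative G - X * (X * derivative G) =
      C ((a : ℚ) - b) * G - C ((a : ℚ) + b) * (X * G) := by
    have ha := one_add_X_mul_derivative_pow 1 a
    have hb := one_add_X_mul_derivative_pow (-1) b
    rw [hG, derivative_mul]
    simp only [map_neg, map_one, map_sub, map_add, map_mul, one_mul] at ha hb ⊢
    linear_combination (1 + -1 * X) ^ b * (1 - X) * ha + (1 + X) ^ a * (1 + X) * hb
  have h2 : ∀ n, (X * derivative G).coeff n = n * G.coeff n := by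
    rintro (_ | n)
    · simp
    · rw [coeff_X_mul, coeff_derivative]; push_cast; ring
  have h3 := congrArg (fun p => coeff p (K + 1)) h1
  simp only [coeff_sub, coeff_C_mul, coeff_X_mul, h2, coeff_derivative] at h3
  push_cast at h3
  linear_combination h3

/-- The solution `q` of the three-term recursion is the sum over `j` of the descent sums with weights
`y` for the single steps. By homogeneity these come from the descent sums with `x = 1`, with
`z = y⁻²`, which avoids the natural number subtraction in `y ^ (K - 2 * j)`. -/
theorem descentSum_recursion {R : Type*} [CommRing R] (w : ℕ → R) (q : ℕ → R) (y z : R)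
    (hz : y ^ 2 * z = 1) (h0 : q 0 = 1) (h1 : q 1 = y)
    (h2 : ∀ K, q (K + 2) = y * q (K + 1) + w (K + 1) * q K) (K n : ℕ) (hn : K < n) :
    q K = y ^ K * ∑ j ∈ Finset.range n, descentSum w K j (fun _ => 1) * z ^ j := by
  induction K using Nat.twoStepInduction generalizing n with
  | zero =>
    obtain ⟨n, rfl⟩ := Nat.exists_eq_add_of_le' hn
    rw [Finset.sum_range_succ']; simp [descentSum, h0]
  | one =>
    obtain ⟨n, rfl⟩ := Nat.exists_eq_add_of_le' hn
    rw [Finset.sum_range_succ']; simp [descentSum, h1]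
  | more K ih1 ih2 =>
    obtain ⟨n, rfl⟩ := Nat.exists_eq_add_of_le' (Nat.zero_lt_of_lt hn)
    rw [h2, ih2 (n + 1) (by omega), ih1 n (by omega), Finset.sum_range_succ', Finset.sum_range_succ']
    simp only [descentSum, one_mul, add_mul, Finset.sum_add_distrib, descentSum_zero_right, one_pow,
      pow_zero, mul_one]
    have : ∑ j ∈ Finset.range n, w (K + 1) * descentSum w K j (fun _ => 1) * z ^ (j + 1) =
        z * (w (K + 1) * ∑ j ∈ Finset.range n, descentSum w K j (fun _ => 1) * z ^ j) := by
      rw [Finset.mul_sum, Finset.mul_sum]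
      exact Finset.sum_congr rfl fun _ _ => by ring
    rw [this]
    linear_combination -y ^ K * w (K + 1) *
      (∑ j ∈ Finset.range n, descentSum w K j (fun _ => 1) * z ^ j) * hz

/-- The squares of the positive eigenvalues `m + 1 - 2 i` are roots of the leading coefficient of
Vanhove's operator. -/
theorem sum_descentSum_eq_zero (m i : ℕ) (hi : 2 * i < m + 1) :
    ∑ k ∈ Finset.range (m / 2 + 2), descentSum (verrillWeight ℤ m) (m + 2) k (fun _ => 1) *
      ((m + 1 - 2 * i : ℤ) ^ 2) ^ (m / 2 + 1 - k) = 0 := by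
  obtain ⟨b, hb⟩ : ∃ b, m + 1 = i + b := ⟨m + 1 - i, by omega⟩
  set G : ℚ[X] := (1 + C 1 * X) ^ b * (1 + C (-1) * X) ^ i with hG
  have hbi : (b : ℚ) = m + 1 - i := by
    have : ((m + 1 : ℕ) : ℚ) = ((i + b : ℕ) : ℚ) := by rw [hb]
    push_cast at this; linear_combination -this
  set y : ℚ := ((m + 1 - 2 * i : ℤ) : ℚ) with hy
  have hy0 : y ≠ 0 := by rw [hy]; exact Int.cast_ne_zero.2 (by omega)
  have hyb : y = b - i := by rw [hy, hbi]; push_cast; ring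
  have hc0 : G.coeff 0 = 1 := by simp [hG, coeff_zero_eq_eval_zero]
  have hc1 : G.coeff 1 = y := by
    have : (derivative G).coeff 0 = y := by
      rw [hyb]
      simp [hG, coeff_zero_eq_eval_zero, derivative_mul, derivative_pow]; ring
    simpa [coeff_derivative] using this
  have hrec := descentSum_recursion (verrillWeight ℚ m) (fun K => (K.factorial : ℚ) * G.coeff K) y
    (y ^ 2)⁻¹ (mul_inv_cancel₀ (pow_ne_zero 2 hy0)) (by simp [hc0]) (by simp [hc1]) (fun K => by
      have := coeff_one_add_mul_one_sub b i K
      rw [← hG] at this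
      simp only [Nat.factorial_succ, verrillWeight]
      push_cast
      rw [hyb, hbi] at *
      linear_combination ((K : ℚ) + 1) * (K.factorial : ℚ) * this) (m + 2) (m + 3) (by omega)
  -- `G` has degree `b + i = m + 1`, so that the continuant of index `m + 2` vanishes.
  have hdeg : G.coeff (m + 2) = 0 := by
    refine coeff_eq_zero_of_natDegree_lt ?_
    have h1 : ∀ s : ℚ, (1 + C s * X).natDegree ≤ 1 := fun s => by
      rw [add_comm]; exact natDegree_linear_le (a := s) (b := 1)
    calc G.natDegree ≤ b * 1 + i * 1 :=
          natDegree_mul_le_of_le (natDegree_pow_le_of_le b (h1 1)) (natDegree_pow_le_of_le i (h1 _))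
      _ < m + 2 := by omega
  simp only [hdeg, mul_zero] at hrec
  have hsum := (mul_eq_zero.1 hrec.symm).resolve_left (pow_ne_zero _ hy0)
  rw [← Finset.sum_subset (Finset.range_mono (show m / 2 + 2 ≤ m + 3 by omega))] at hsum
  · have : ((∑ k ∈ Finset.range (m / 2 + 2), descentSum (verrillWeight ℤ m) (m + 2) k (fun _ => 1) *
      ((m + 1 - 2 * i : ℤ) ^ 2) ^ (m / 2 + 1 - k) : ℤ) : ℚ) = 0 := by
      rw [← mul_zero ((y ^ 2) ^ (m / 2 + 1)), ← hsum, Finset.mul_sum, Int.cast_sum]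
      refine Finset.sum_congr rfl fun k hk => ?_
      have hk' : k ≤ m / 2 + 1 := by have := Finset.mem_range.1 hk; omega
      rw [Int.cast_mul, Int.cast_pow, Int.cast_pow, ← hy, pow_sub₀ _ (pow_ne_zero 2 hy0) hk',
        ← eq_intCast (Int.castRingHom ℚ), map_descentSum]
      simp only [map_verrillWeight, map_one, inv_pow]
      ring
    exact_mod_cast this
  · intro k _ hk
    rw [descentSum_eq_zero _ _ _ _ (by simp at hk; omega), zero_mul]

/-- The characteristic polynomial of the Sylvester-Kac matrix of size `m + 2`, whose eigenvalues
are `m + 1, m - 1, …, -(m + 1)`, in terms of the squares of the eigenvalues. -/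
theorem sum_descentSum_one (m : ℕ) :
    ∑ k ∈ Finset.range (m / 2 + 2),
        C (descentSum (verrillWeight ℤ m) (m + 2) k (fun _ => 1)) * X ^ (m / 2 + 1 - k) =
      ∏ n ∈ (Finset.Icc 1 (m + 1)).filter (fun n => n % 2 = (m + 1) % 2),
        (X - C ((n : ℤ) ^ 2)) := by
  set S := (Finset.Icc 1 (m + 1)).filter (fun n => n % 2 = (m + 1) % 2) with hS
  have hinj : Set.InjOn (fun n : ℕ => (n : ℤ) ^ 2) S := by
    intro a _ b _ h
    have : a ^ 2 = b ^ 2 := by simpa only [← Nat.cast_pow, Nat.cast_inj] using h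
    exact Nat.pow_left_injective two_ne_zero this
  have hcard : S.card = m / 2 + 1 := by
    have : S = (Finset.range (m / 2 + 1)).image (fun i => m + 1 - 2 * i) := by
      ext n
      simp only [hS, Finset.mem_filter, Finset.mem_Icc, Finset.mem_image, Finset.mem_range]
      constructor
      · rintro ⟨h1, h2⟩; exact ⟨(m + 1 - n) / 2, by omega, by omega⟩
      · rintro ⟨i, hi, rfl⟩; omega
    rw [this, Finset.card_image_of_injOn, Finset.card_range]
    intro i hi j hj h
    simp at hi hj h; omega
  have hprod : (∏ n ∈ S, (X - C ((n : ℤ) ^ 2)) : ℤ[X]).degree = (m / 2 + 1 : ℕ) := by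
    rw [degree_prod, Finset.sum_congr rfl fun n _ => degree_X_sub_C _]
    simp [hcard]
  have hmonic : (∏ n ∈ S, (X - C ((n : ℤ) ^ 2)) : ℤ[X]).Monic :=
    monic_prod_of_monic _ _ fun n _ => monic_X_sub_C _
  have hlow : (∑ k ∈ Finset.range (m / 2 + 1),
      C (descentSum (verrillWeight ℤ m) (m + 2) (k + 1) (fun _ => 1)) *
        X ^ (m / 2 + 1 - (k + 1)) : ℤ[X]).degree < (m / 2 + 1 : ℕ) := by
    refine (degree_sum_le _ _).trans_lt ((Finset.sup_lt_iff (WithBot.bot_lt_coe _)).2 fun k hk => ?_)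
    refine (degree_C_mul_X_pow_le _ _).trans_lt ?_
    exact_mod_cast (by omega : m / 2 + 1 - (k + 1) < m / 2 + 1)
  refine Polynomial.eq_of_degree_sub_lt_of_eval_finset_eq (S.image fun n : ℕ => (n : ℤ) ^ 2) ?_ ?_
  · -- Both sides are monic of degree `m / 2 + 1`; on the left, the leading term is that of `k = 0`.
    rw [Finset.card_image_of_injOn hinj, hcard, Finset.sum_range_succ']
    simp only [descentSum_zero_right, one_pow, map_one, one_mul, Nat.sub_zero]
    rw [add_sub_assoc]
    refine (degree_add_le _ _).trans_lt (max_lt hlow ?_)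
    have := degree_sub_lt_left (p := (X ^ (m / 2 + 1) : ℤ[X])) (q := ∏ n ∈ S, (X - C ((n : ℤ) ^ 2)))
      (by rw [hprod, degree_X_pow]) (pow_ne_zero _ X_ne_zero) (by rw [hmonic.leadingCoeff]; simp)
    rwa [degree_X_pow] at this
  · intro r hr
    obtain ⟨n, hn, rfl⟩ := Finset.mem_image.1 hr
    rw [eval_prod, Finset.prod_eq_zero hn (by simp)]
    obtain ⟨i, hi, hni⟩ : ∃ i, 2 * i < m + 1 ∧ (n : ℤ) = m + 1 - 2 * i := by
      simp only [hS, Finset.mem_filter, Finset.mem_Icc] at hn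
      exact ⟨(m + 1 - n) / 2, by omega, by omega⟩
    rw [hni, ← sum_descentSum_eq_zero m i hi, eval_finsetSum]
    simp

/-! ### Polynomials in `ϑ̂` -/

theorem sum_stirlingSecond_succ {M : Type*} [AddCommMonoid M] (T : ℕ → M) (i : ℕ) :
    ∑ j ∈ Finset.range (i + 1), Nat.stirlingSecond (i + 1) (j + 1) • ((j + 1) • T j + T (j + 1)) =
      ∑ j ∈ Finset.range (i + 2), Nat.stirlingSecond (i + 2) (j + 1) • T j := by
  simp only [Nat.stirlingSecond_succ_succ (i + 1), add_smul _ (Nat.stirlingSecond _ _),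
    Finset.sum_add_distrib, smul_add]
  congr 1
  · rw [Finset.sum_range_succ _ (i + 1),
      Nat.stirlingSecond_eq_zero_of_lt (show i + 1 < i + 1 + 1 by omega), mul_zero, zero_smul,
      add_zero]
    exact Finset.sum_congr rfl fun j _ => by rw [← mul_smul, mul_comm]
  · rw [Finset.sum_range_succ' _ (i + 1), Nat.stirlingSecond_succ_zero, zero_smul, add_zero]

/-- The coefficient of `u ^ j * D ^ j` in the normal form of the operator `p(ϑ̂)`. -/
def thetaCoeff (p : ℤ[X]) (j : ℕ) : ℤ :=
  p.sum fun i c => c * (Nat.stirlingSecond (i + 1) (j + 1) : ℤ)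

section ThetaHat

open Filter Topology

variable {𝕜 E : Type*} [RCLike 𝕜] [NormedAddCommGroup E] [NormedSpace 𝕜 E]

/-- The normal form of `ϑ̂ ^ i`. It holds in a neighbourhood, as is needed to differentiate it in the
induction step. -/
theorem thetaHat_iterate_eventuallyEq {n : ℕ} {f : 𝕜 → E} {u : 𝕜} (hf : ContDiffAt 𝕜 n f u)
    (i : ℕ) (hi : i ≤ n) : thetaHat^[i] f =ᶠ[𝓝 u] fun v =>
      ∑ j ∈ Finset.range (i + 1), Nat.stirlingSecond (i + 1) (j + 1) •
        (v ^ j • iteratedDeriv j f v) := by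
  induction i with
  | zero => exact Eventually.of_forall fun v => by simp [Nat.stirlingSecond_self 1]
  | succ i ih =>
    filter_upwards [(ih (by omega)).eventuallyEq_nhds, hf.eventually (by simp)] with v hv hfv
    have hd : ∀ j ∈ Finset.range (i + 1),
        HasDerivAt (fun v => Nat.stirlingSecond (i + 1) (j + 1) •
          (v ^ (j + 1) • iteratedDeriv j f v))
        (Nat.stirlingSecond (i + 1) (j + 1) •
          ((j + 1) • (v ^ j • iteratedDeriv j f v) +
            v ^ (j + 1) • iteratedDeriv (j + 1) f v)) v := by
      intro j hj
      have hj' : j < n := by have := Finset.mem_range.1 hj; omega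
      have h1 : HasDerivAt (iteratedDeriv j f) (iteratedDeriv (j + 1) f v) v := by
        rw [iteratedDeriv_succ]
        have h0 := (contDiffWithinAt_univ.2 hfv).differentiableWithinAt_iteratedDerivWithin
          (m := j) (by exact_mod_cast hj') (by simp)
        rw [iteratedDerivWithin_univ, differentiableWithinAt_univ] at h0
        exact h0.hasDerivAt
      have h2 := ((hasDerivAt_pow (j + 1) v).smul h1).const_smul
        (Nat.stirlingSecond (i + 1) (j + 1))
      convert! h2 using 2
      rw [add_comm, Nat.add_sub_cancel, mul_smul, ← Nat.cast_smul_eq_nsmul 𝕜 (j + 1)]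
    have h3 : (fun w => w • (thetaHat^[i] f) w) =ᶠ[𝓝 v] fun w =>
        ∑ j ∈ Finset.range (i + 1), Nat.stirlingSecond (i + 1) (j + 1) •
          (w ^ (j + 1) • iteratedDeriv j f w) := by
      filter_upwards [hv] with w hw
      rw [hw, Finset.smul_sum]
      refine Finset.sum_congr rfl fun j _ => ?_
      rw [smul_comm, pow_succ', mul_smul]
    rw [Function.iterate_succ_apply', thetaHat, h3.deriv_eq, (HasDerivAt.fun_sum hd).deriv,
      sum_stirlingSecond_succ (fun j => v ^ j • iteratedDeriv j f v)]

theorem polyThetaHat_eq {m : ℕ} {f : 𝕜 → E} {u : 𝕜} (hf : ContDiffAt 𝕜 m f u) (p : ℤ[X])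
    (hp : p.natDegree ≤ m) : polyThetaHat p f u =
      ∑ j ∈ Finset.range (m + 1), thetaCoeff p j • (u ^ j • iteratedDeriv j f u) := by
  have h1 : ∀ i ∈ Finset.range (m + 1), p.coeff i • (thetaHat^[i] f) u =
      ∑ j ∈ Finset.range (m + 1),
        (p.coeff i * (Nat.stirlingSecond (i + 1) (j + 1) : ℤ)) • (u ^ j • iteratedDeriv j f u) := by
    intro i hi
    have hi' : i ≤ m := by have := Finset.mem_range.1 hi; omega
    rw [(thetaHat_iterate_eventuallyEq hf i hi').self_of_nhds, Finset.smul_sum]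
    simp only [mul_smul, natCast_zsmul]
    refine Finset.sum_subset (Finset.range_mono (by omega)) fun j _ hj => ?_
    rw [Nat.stirlingSecond_eq_zero_of_lt (by simp at hj; omega)]
    simp
  rw [polyThetaHat, p.sum_over_range' (by simp) (m + 1) (by omega), Finset.sum_congr rfl h1,
    Finset.sum_comm]
  refine Finset.sum_congr rfl fun j _ => ?_
  rw [← Finset.sum_smul, thetaCoeff, p.sum_over_range' (by simp) (m + 1) (by omega)]

end ThetaHat

theorem succ_pow_eq_sum_descFactorial (n i : ℕ) : ((n : ℤ) + 1) ^ i =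
    ∑ j ∈ Finset.range (i + 1), Nat.stirlingSecond (i + 1) (j + 1) • (n.descFactorial j : ℤ) := by
  induction i with
  | zero => simp [Nat.stirlingSecond_self 1]
  | succ i ih =>
    rw [pow_succ', ih, ← sum_stirlingSecond_succ, Finset.mul_sum]
    refine Finset.sum_congr rfl fun j _ => ?_
    have : ((n.descFactorial (j + 1) : ℕ) : ℤ) = ((n : ℤ) - j) * n.descFactorial j := by
      rw [Nat.descFactorial_succ]
      by_cases h : j ≤ n
      · push_cast [h]; ring
      · simp [Nat.descFactorial_of_lt (show n < j by omega)]
    rw [this]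
    simp only [nsmul_eq_mul]
    push_cast
    ring

/-- The operator `p(ϑ̂)` has the eigenvector `u ^ n` with the eigenvalue `p(n + 1)`. -/
theorem eval_succ_eq_sum_thetaCoeff {m : ℕ} (p : ℤ[X]) (hp : p.natDegree ≤ m) (n : ℕ) :
    p.eval ((n : ℤ) + 1) =
      ∑ j ∈ Finset.range (m + 1), thetaCoeff p j * (n.descFactorial j : ℤ) := by
  have h1 : ∀ i ∈ Finset.range (m + 1), p.coeff i * ((n : ℤ) + 1) ^ i =
      ∑ j ∈ Finset.range (m + 1),
        (p.coeff i * (Nat.stirlingSecond (i + 1) (j + 1) : ℤ)) * n.descFactorial j := by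
    intro i hi
    rw [succ_pow_eq_sum_descFactorial, Finset.mul_sum]
    simp only [mul_assoc, nsmul_eq_mul]
    refine Finset.sum_subset (Finset.range_mono (by simp at hi; omega)) fun j _ hj => ?_
    rw [Nat.stirlingSecond_eq_zero_of_lt (by simp at hj; omega)]
    simp
  rw [eval_eq_sum_range' (show p.natDegree < m + 1 by omega), Finset.sum_congr rfl h1,
    Finset.sum_comm]
  refine Finset.sum_congr rfl fun j _ => ?_
  rw [← Finset.sum_mul, thetaCoeff, p.sum_over_range' (by simp) (m + 1) (by omega)]

/-- The matrix of the falling factorials `n (n - 1) ⋯ (n - j + 1)` is triangular with nonzero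
diagonal entries. -/
theorem eq_zero_of_sum_descFactorial {R : Type*} [CommRing R] [IsDomain R] [CharZero R] {m r : ℕ}
    (d : ℕ → R)
    (h : ∀ n < r, ∑ j ∈ Finset.range (m + 1), d j * (n.descFactorial j : R) = 0)
    (j : ℕ) (hj : j < r) (hjm : j ≤ m) : d j = 0 := by
  induction j using Nat.strong_induction_on with
  | _ j ih =>
    have h1 := h j hj
    rw [Finset.sum_eq_single j] at h1
    · rw [Nat.descFactorial_self] at h1
      exact (mul_eq_zero.1 h1).resolve_right (by exact_mod_cast j.factorial_ne_zero)
    · intro i _ hij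
      rcases lt_or_gt_of_ne hij with h2 | h2
      · rw [ih i h2 (by omega) (by omega), zero_mul]
      · rw [Nat.descFactorial_of_lt h2]; simp
    · intro h2; simp at h2; omega

/-- If `p` vanishes at `1, …, r`, then `p(ϑ̂)` is divisible by `u ^ r * D ^ r` from the right. -/
theorem thetaCoeff_eq_zero {m : ℕ} (p : ℤ[X]) (hp : p.natDegree ≤ m) (r : ℕ)
    (h : ∀ n < r, p.eval ((n : ℤ) + 1) = 0) (j : ℕ) (hj : j < r) (hjm : j ≤ m) :
    thetaCoeff p j = 0 :=
  eq_zero_of_sum_descFactorial (thetaCoeff p)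
    (fun n hn => (eval_succ_eq_sum_thetaCoeff p hp n).symm.trans (h n hn)) j hj hjm

theorem thetaCoeff_top {m : ℕ} (p : ℤ[X]) (hp : p.natDegree ≤ m) :
    thetaCoeff p m = p.coeff m := by
  rw [thetaCoeff, p.sum_over_range' (by simp) (m + 1) (by omega), Finset.sum_range_succ,
    Finset.sum_eq_zero fun i hi => ?_]
  · simp [Nat.stirlingSecond_self]
  · rw [Nat.stirlingSecond_eq_zero_of_lt (by simp at hi; omega)]; simp

/-! ### The coefficients of Vanhove's operator -/

/-- The polynomial `𝒱_{m,k}(k - X)`. -/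
noncomputable def verrillShift (m k : ℕ) : ℤ[X] := (verrillPoly m k).comp (C (k : ℤ) - X)

theorem natDegree_C_sub_X (a : ℤ) : (C a - X).natDegree = 1 := by
  rw [natDegree_sub, natDegree_X_sub_C]

theorem natDegree_verrillShift_le (m k : ℕ) : (verrillShift m k).natDegree ≤ m := by
  rw [verrillShift, natDegree_comp, natDegree_C_sub_X, mul_one]
  exact (verrillPoly_leading m k).1

theorem coeff_verrillShift (m k : ℕ) : (verrillShift m k).coeff m =
    (-1) ^ m * descentSum (verrillWeight ℤ m) (m + 2) k (fun _ => 1) := by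
  obtain ⟨h1, h2⟩ := verrillPoly_leading m k
  rw [← h2]
  rcases h1.lt_or_eq with h | h
  · rw [coeff_eq_zero_of_natDegree_lt h, coeff_eq_zero_of_natDegree_lt, mul_zero]
    rwa [verrillShift, natDegree_comp, natDegree_C_sub_X, mul_one]
  · have h3 := coeff_comp_degree_mul_degree (p := verrillPoly m k) (q := C (k : ℤ) - X)
      (by rw [natDegree_C_sub_X]; exact one_ne_zero)
    have h4 : (C (k : ℤ) - X).leadingCoeff = -1 := by
      rw [leadingCoeff, natDegree_C_sub_X, coeff_sub, coeff_X_one, coeff_C]; simp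
    rw [natDegree_C_sub_X, h4, h, mul_one, leadingCoeff, h] at h3
    rw [verrillShift, h3, mul_comm]

theorem eval_verrillShift (m k n : ℕ) : (verrillShift m k).eval ((n : ℤ) + 1) =
    (verrillPoly m k).eval ((k : ℤ) - n - 1) := by
  rw [verrillShift, eval_comp, eval_sub, eval_C, eval_X, sub_sub]

theorem eval_verrillShift_eq_zero (m k n : ℕ) (h : n + 1 < k) :
    (verrillShift m k).eval ((n : ℤ) + 1) = 0 := by
  obtain ⟨k, rfl⟩ := Nat.exists_eq_add_of_lt h
  rw [eval_verrillShift, eval_verrillPoly]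
  refine mul_eq_zero_of_right _
    (Finset.prod_eq_zero (i := k + 1) (Finset.mem_Icc.2 ⟨by omega, by omega⟩) ?_)
  push_cast; ring

theorem thetaCoeff_verrillShift_eq_zero (m k j : ℕ) (hj : j ≤ m) (h : j + 1 < k) :
    thetaCoeff (verrillShift m k) j = 0 :=
  thetaCoeff_eq_zero _ (natDegree_verrillShift_le m k) (k - 1)
    (fun n hn => eval_verrillShift_eq_zero m k n (by omega)) j (by omega) hj

/-- The coefficients of the operator `(-1) ^ m * ∑ k, u ^ (1 - k) * 𝒱_{m,k}(k - ϑ̂)`. The natural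
number subtraction in the exponent is harmless, because `thetaCoeff (verrillShift m k) j = 0` for
`j + 1 < k`. -/
noncomputable def vanhoveCoeff (m : ℕ) (j : Fin (m + 1)) : ℤ[X] :=
  C ((-1) ^ m) * ∑ k ∈ Finset.range (m / 2 + 2),
    C (thetaCoeff (verrillShift m k) j) * X ^ ((j : ℕ) + 1 - k)

theorem aeval_vanhoveCoeff {K : Type*} [Field K] (m : ℕ) (j : Fin (m + 1)) (u : K) (hu : u ≠ 0) :
    aeval u (vanhoveCoeff m j) = (-1) ^ m * ∑ k ∈ Finset.range (m / 2 + 2),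
      u ^ (1 - (k : ℤ)) * ((thetaCoeff (verrillShift m k) j : K) * u ^ (j : ℕ)) := by
  simp only [vanhoveCoeff, map_mul, map_sum, map_pow, aeval_X, map_neg, map_one,
    eq_intCast]
  congr 1
  refine Finset.sum_congr rfl fun k _ => ?_
  by_cases h : (j : ℕ) + 1 < k
  · rw [thetaCoeff_verrillShift_eq_zero m k j (by omega) h]; simp
  · have h1 : u ^ ((j : ℕ) + 1 - k) = u ^ (1 - (k : ℤ)) * u ^ (j : ℕ) := by
      rw [← zpow_natCast, ← zpow_natCast, ← zpow_add₀ hu]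
      congr 1
      omega
    rw [h1]; simp; ring

theorem vanhoveCoeff_last (m : ℕ) : vanhoveCoeff m (Fin.last m) = X ^ ((m + 1) / 2) *
    ∏ n ∈ (Finset.Icc 1 (m + 1)).filter (fun n => n % 2 = (m + 1) % 2),
      (X - C ((n : ℤ) ^ 2)) := by
  rw [← sum_descentSum_one, vanhoveCoeff, Finset.mul_sum, Finset.mul_sum]
  refine Finset.sum_congr rfl fun k hk => ?_
  have hk' := Finset.mem_range.1 hk
  rw [Fin.val_last, thetaCoeff_top _ (natDegree_verrillShift_le m k), coeff_verrillShift,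
    show m + 1 - k = (m + 1) / 2 + (m / 2 + 1 - k) by omega, pow_add, C_mul]
  have h : (C ((-1) ^ m) * C ((-1) ^ m) : ℤ[X]) = 1 := by
    rw [← C_mul, ← mul_pow]; simp
  linear_combination C (descentSum (verrillWeight ℤ m) (m + 2) k fun _ => 1) *
    X ^ ((m + 1) / 2) * X ^ (m / 2 + 1 - k) * h

theorem polyDiffOp_vanhoveCoeff {𝕜 E : Type*} [RCLike 𝕜] [NormedAddCommGroup E] [NormedSpace 𝕜 E]
    (m : ℕ) (f : 𝕜 → E) (u : 𝕜) (hu : u ≠ 0) (hf : ContDiffAt 𝕜 m f u) :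
    polyDiffOp (vanhoveCoeff m) f u = (-1 : 𝕜) ^ m • ∑ k ∈ Finset.range (m / 2 + 2),
      u ^ (1 - (k : ℤ)) • polyThetaHat (verrillShift m k) f u := by
  simp only [polyThetaHat_eq hf _ (natDegree_verrillShift_le m _), polyDiffOp,
    aeval_vanhoveCoeff m _ u hu]
  rw [Fin.sum_univ_eq_sum_range (fun j => ((-1) ^ m * ∑ k ∈ Finset.range (m / 2 + 2),
      u ^ (1 - (k : ℤ)) * ((thetaCoeff (verrillShift m k) j : 𝕜) * u ^ j)) •
      iteratedDeriv j f u) (m + 1)]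
  simp only [mul_smul, ← Finset.smul_sum, Finset.sum_smul]
  congr 1
  rw [Finset.sum_comm]
  simp only [Finset.smul_sum, Int.cast_smul_eq_zsmul]

/-- The effect of Vanhove's operator on `u ^ n`, whose `j`-th derivative is
`n.descFactorial j * u ^ n * (u ^ j)⁻¹`. -/
theorem sum_vanhoveCoeff_descFactorial (m n : ℕ) (u : ℝ) (hu : u ≠ 0) :
    ∑ j : Fin (m + 1), aeval u (vanhoveCoeff m j) * ((u ^ (j : ℕ))⁻¹ * n.descFactorial j) =
      (-1) ^ m * ∑ k ∈ Finset.range (m / 2 + 2),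
        u ^ (1 - (k : ℤ)) * ((verrillPoly m k).eval ((k : ℤ) - n - 1) : ℤ) := by
  simp only [aeval_vanhoveCoeff m _ u hu, ← eval_verrillShift,
    eval_succ_eq_sum_thetaCoeff _ (natDegree_verrillShift_le m _), mul_assoc, Finset.sum_mul,
    ← Finset.mul_sum]
  congr 1
  rw [Finset.sum_comm]
  refine Finset.sum_congr rfl fun k _ => ?_
  rw [← Finset.mul_sum, Finset.sum_range, Int.cast_sum]
  congr 1
  refine Finset.sum_congr rfl fun j _ => ?_
  rw [mul_inv_cancel_left₀ (pow_ne_zero _ hu)]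
  push_cast; rfl

/-! ### Entire power series -/

/-- The sum `∑ n, b n * x ^ n` of a power series. -/
noncomputable def seriesSum (b : ℕ → ℝ) (x : ℝ) : ℝ := ∑' n, b n * x ^ n

/-- The power series with coefficients `b` has infinite radius of convergence. -/
def IsEntireSeq (b : ℕ → ℝ) : Prop := ∀ r : ℝ, Summable fun n => b n * r ^ n

/-- The coefficients of the derivative of a power series. -/
def derivSeq (b : ℕ → ℝ) (n : ℕ) : ℝ := ((n : ℝ) + 1) * b (n + 1)

/-- The coefficients of `x` times a power series in `x`. -/
def shiftSeq (b : ℕ → ℝ) : ℕ → ℝ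
  | 0 => 0
  | n + 1 => b n

namespace IsEntireSeq

variable {b b' : ℕ → ℝ}

theorem const_mul (hb : IsEntireSeq b) (c : ℝ) : IsEntireSeq fun n => c * b n := fun r => by
  simpa only [mul_assoc] using (hb r).mul_left c

theorem sub (hb : IsEntireSeq b) (hb' : IsEntireSeq b') : IsEntireSeq fun n => b n - b' n :=
  fun r => by simpa only [sub_mul] using (hb r).sub (hb' r)

theorem natCast_mul (hb : IsEntireSeq b) : IsEntireSeq fun n => (n : ℝ) * b n := fun r => by
  refine Summable.of_norm_bounded (hb (2 * r)).norm fun n => ?_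
  have h : (n : ℝ) ≤ 2 ^ n := by exact_mod_cast Nat.lt_two_pow_self.le
  rw [mul_assoc, norm_mul, mul_pow, mul_left_comm, norm_mul (2 ^ n)]
  refine mul_le_mul_of_nonneg_right ?_ (norm_nonneg _)
  simpa using h

theorem tail (hb : IsEntireSeq b) : IsEntireSeq fun n => b (n + 1) := fun r => by
  by_cases hr : r = 0
  · refine summable_of_ne_finset_zero (s := {0}) fun n hn => ?_
    rw [hr, zero_pow (by simpa using hn), mul_zero]
  · have h := ((summable_nat_add_iff 1).2 (hb r)).mul_right r⁻¹
    refine h.congr fun n => ?_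
    rw [pow_succ, ← mul_assoc, mul_inv_cancel_right₀ hr]

theorem shift (hb : IsEntireSeq b) : IsEntireSeq (shiftSeq b) := fun r => by
  rw [← summable_nat_add_iff 1]
  refine ((hb r).mul_right r).congr fun n => ?_
  simp only [shiftSeq]; ring

theorem deriv (hb : IsEntireSeq b) : IsEntireSeq (derivSeq b) := fun r => by
  simpa [derivSeq] using hb.natCast_mul.tail r

end IsEntireSeq

theorem seriesSum_const_mul (b : ℕ → ℝ) (c x : ℝ) :
    seriesSum (fun n => c * b n) x = c * seriesSum b x := by
  simp only [seriesSum, mul_assoc, tsum_mul_left]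

theorem seriesSum_sub {b b' : ℕ → ℝ} (hb : IsEntireSeq b) (hb' : IsEntireSeq b') (x : ℝ) :
    seriesSum (fun n => b n - b' n) x = seriesSum b x - seriesSum b' x := by
  simp only [seriesSum, sub_mul, (hb x).tsum_sub (hb' x)]

theorem seriesSum_eq_add {b : ℕ → ℝ} (hb : IsEntireSeq b) (x : ℝ) :
    seriesSum b x = b 0 + x * seriesSum (fun n => b (n + 1)) x := by
  rw [seriesSum, (hb x).tsum_eq_zero_add, seriesSum, ← tsum_mul_left, pow_zero, mul_one]
  congr 1
  exact tsum_congr fun n => by ring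

theorem seriesSum_shiftSeq {b : ℕ → ℝ} (hb : IsEntireSeq b) (x : ℝ) :
    seriesSum (shiftSeq b) x = x * seriesSum b x := by
  rw [seriesSum_eq_add hb.shift]; simp [shiftSeq]

theorem hasDerivAt_seriesSum {b : ℕ → ℝ} (hb : IsEntireSeq b) (x : ℝ) :
    HasDerivAt (seriesSum b) (seriesSum (derivSeq b) x) x := by
  have hR : (1 : ℝ) ≤ |x| + 1 := by linarith [abs_nonneg x]
  have h := hasDerivAt_tsum_of_isPreconnected (g := fun n y => b n * y ^ n)
    (g' := fun n y => b n * ((n : ℝ) * y ^ (n - 1))) (hb.natCast_mul (|x| + 1)).norm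
    (Metric.isOpen_ball (x := (0 : ℝ)) (ε := |x| + 1)) (convex_ball _ _).isPreconnected
    (fun n y _ => (hasDerivAt_pow n y).const_mul (b n)) (fun n y hy => by
      have hy' : |y| ≤ |x| + 1 := by simpa using (Metric.mem_ball.1 hy).le
      rw [mul_left_comm, mul_assoc, norm_mul, norm_mul, norm_mul, norm_mul]
      refine mul_le_mul_of_nonneg_left (mul_le_mul_of_nonneg_left ?_ (norm_nonneg _))
        (norm_nonneg _)
      rw [norm_pow, norm_pow, Real.norm_eq_abs, Real.norm_eq_abs,
        abs_of_nonneg (zero_le_one.trans hR)]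
      exact (pow_le_pow_left₀ (abs_nonneg y) hy' _).trans
        (pow_le_pow_right₀ hR (Nat.sub_le n 1)))
    (y₀ := 0) (by simp; linarith [abs_nonneg x]) (hb 0) (y := x) (by simp)
  convert! h using 1
  have hs : Summable fun n => b n * ((n : ℝ) * x ^ (n - 1)) := by
    rw [← summable_nat_add_iff 1]
    refine (hb.deriv x).congr fun n => ?_
    simp only [derivSeq, Nat.add_sub_cancel]; push_cast; ring
  rw [hs.tsum_eq_zero_add, seriesSum]
  simp only [Nat.cast_zero, zero_mul, mul_zero, zero_add]
  refine tsum_congr fun n => ?_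
  simp only [derivSeq, Nat.add_sub_cancel]; push_cast; ring

theorem mul_seriesSum_derivSeq {b : ℕ → ℝ} (hb : IsEntireSeq b) (x : ℝ) :
    x * seriesSum (derivSeq b) x = seriesSum (fun n => (n : ℝ) * b n) x := by
  rw [seriesSum_eq_add hb.natCast_mul]; simp [funext (fun n => derivSeq.eq_1 b n)]

theorem derivSeq_iterate (b : ℕ → ℝ) (j n : ℕ) :
    derivSeq^[j] b n = (n + j).descFactorial j * b (n + j) := by
  induction j generalizing b with
  | zero => simp
  | succ j ih =>
    rw [Function.iterate_succ_apply, ih, derivSeq, ← add_assoc, Nat.succ_descFactorial_succ]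
    push_cast; ring

theorem iteratedDeriv_seriesSum {b : ℕ → ℝ} (hb : IsEntireSeq b) (j : ℕ) :
    iteratedDeriv j (seriesSum b) = seriesSum (derivSeq^[j] b) := by
  induction j generalizing b with
  | zero => simp
  | succ j ih =>
    rw [iteratedDeriv_succ', funext fun x => (hasDerivAt_seriesSum hb x).deriv, ih hb.deriv,
      Function.iterate_succ_apply]

theorem pow_mul_iteratedDeriv_seriesSum {b : ℕ → ℝ} (hb : IsEntireSeq b) (j : ℕ) (x : ℝ) :
    Summable (fun n => (n.descFactorial j : ℝ) * b n * x ^ n) ∧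
    x ^ j * iteratedDeriv j (seriesSum b) x =
      seriesSum (fun n => (n.descFactorial j : ℝ) * b n) x := by
  have hj : IsEntireSeq (derivSeq^[j] b) := by
    induction j generalizing b with
    | zero => exact hb
    | succ j ih => exact ih hb.deriv
  have h1 : ∀ n, x ^ j * (derivSeq^[j] b n * x ^ n) =
      ((n + j).descFactorial j : ℝ) * b (n + j) * x ^ (n + j) := fun n => by
    rw [derivSeq_iterate]; ring
  have hs : Summable fun n => (n.descFactorial j : ℝ) * b n * x ^ n := by
    rw [← summable_nat_add_iff j]
    exact ((hj x).mul_left _).congr h1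
  refine ⟨hs, ?_⟩
  rw [iteratedDeriv_seriesSum hb, seriesSum, seriesSum, ← tsum_mul_left, tsum_congr h1,
    ← hs.sum_add_tsum_nat_add j, Finset.sum_eq_zero, zero_add]
  intro n hn
  rw [Nat.descFactorial_of_lt (by simpa using hn)]; simp

theorem eq_zero_of_seriesSum_eq_zero {b : ℕ → ℝ} (hb : IsEntireSeq b)
    (h : ∀ x, 0 < x → seriesSum b x = 0) (n : ℕ) : b n = 0 := by
  have key : ∀ {b : ℕ → ℝ}, IsEntireSeq b → (∀ x, 0 < x → seriesSum b x = 0) → b 0 = 0 := by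
    intro b hb h
    have hc : Continuous (seriesSum b) :=
      continuous_iff_continuousAt.2 fun x => (hasDerivAt_seriesSum hb x).continuousAt
    have h0 : (0 : ℝ) ∈ closure (Set.Ioi 0) := by simp
    have h1 : closure (Set.Ioi 0) ⊆ {x | seriesSum b x = 0} :=
      closure_minimal (fun x hx => h x hx) (isClosed_eq hc continuous_const)
    have h2 : seriesSum b 0 = 0 := h1 h0
    simpa [seriesSum_eq_add hb] using h2
  induction n generalizing b with
  | zero => exact key hb h
  | succ n ih =>
    refine ih hb.tail fun x hx => ?_
    have h1 := h x hx
    rw [seriesSum_eq_add hb, key hb h, zero_add] at h1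
    exact (mul_eq_zero.1 h1).resolve_left hx.ne'

/-! ### The Bessel function -/

/-- The coefficients of the power series of `I₀(√u t)` in `t ^ 2`. -/
noncomputable def besselSeq (u : ℝ) (n : ℕ) : ℝ := (u / 4) ^ n / (n.factorial : ℝ) ^ 2

theorem isEntireSeq_besselSeq (u : ℝ) : IsEntireSeq (besselSeq u) := fun r => by
  refine Summable.of_norm_bounded (Real.summable_pow_div_factorial ‖u / 4 * r‖) fun n => ?_
  have h : (1 : ℝ) ≤ n.factorial := by exact_mod_cast n.factorial_pos
  rw [besselSeq, div_mul_eq_mul_div, ← mul_pow, norm_div, norm_pow, norm_pow, Real.norm_natCast]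
  gcongr
  nlinarith

theorem integral_cos_pow_even (n : ℕ) : ∫ φ in (0 : ℝ)..Real.pi, Real.cos φ ^ (2 * n) =
    Real.pi * ((2 * n).factorial / (4 ^ n * (n.factorial : ℝ) ^ 2)) := by
  induction n with
  | zero => simp
  | succ n ih =>
    rw [mul_add, mul_one, integral_cos_pow, ih]
    have : (n.factorial : ℝ) ≠ 0 := by exact_mod_cast n.factorial_ne_zero
    simp only [Real.sin_pi, Real.sin_zero, Nat.factorial_succ]
    push_cast
    field_simp
    ring

theorem integral_cos_pow_odd (n : ℕ) :
    ∫ φ in (0 : ℝ)..Real.pi, Real.cos φ ^ (2 * n + 1) = 0 := by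
  induction n with
  | zero => simp
  | succ n ih => rw [show 2 * (n + 1) + 1 = 2 * n + 1 + 2 by ring, integral_cos_pow, ih]; simp

theorem besselI0_eq_seriesSum (x : ℝ) : besselI0 x = seriesSum (besselSeq 1) (x ^ 2) := by
  have h1 : HasSum (fun n : ℕ => ∫ φ in (0 : ℝ)..Real.pi, (x * Real.cos φ) ^ n / n.factorial)
      (∫ φ in (0 : ℝ)..Real.pi, Real.exp (x * Real.cos φ)) := by
    refine intervalIntegral.hasSum_integral_of_dominated_convergence
      (fun n _ => |x| ^ n / n.factorial) (fun n => by fun_prop) (fun n => ?_) ?_ ?_ ?_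
    · refine Filter.Eventually.of_forall fun φ _ => ?_
      rw [norm_div, norm_pow, Real.norm_natCast, norm_mul]
      gcongr
      simpa using mul_le_of_le_one_right (abs_nonneg x) (Real.abs_cos_le_one φ)
    · exact Filter.Eventually.of_forall fun φ _ => Real.summable_pow_div_factorial _
    · simp
    · refine Filter.Eventually.of_forall fun φ _ => ?_
      rw [Real.exp_eq_exp_ℝ]
      exact NormedSpace.expSeries_div_hasSum_exp (x * Real.cos φ)
  have h2 : ∀ n : ℕ, ∫ φ in (0 : ℝ)..Real.pi, (x * Real.cos φ) ^ n / n.factorial =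
      x ^ n / n.factorial * ∫ φ in (0 : ℝ)..Real.pi, Real.cos φ ^ n := fun n => by
    rw [← intervalIntegral.integral_const_mul]
    congr 1
    ext φ
    ring
  have h3 : ∀ n : ℕ, ∫ φ in (0 : ℝ)..Real.pi, (x * Real.cos φ) ^ (2 * n) / (2 * n).factorial =
      Real.pi * (besselSeq 1 n * (x ^ 2) ^ n) := fun n => by
    have : ((2 * n).factorial : ℝ) ≠ 0 := by exact_mod_cast (2 * n).factorial_ne_zero
    rw [h2, integral_cos_pow_even, besselSeq, one_div, inv_pow, pow_mul]
    field_simp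
  have h4 : HasSum (fun n : ℕ =>
      ∫ φ in (0 : ℝ)..Real.pi, (x * Real.cos φ) ^ n / n.factorial)
      (Real.pi * seriesSum (besselSeq 1) (x ^ 2) + 0) := by
    refine HasSum.even_add_odd ?_ ?_
    · simp only [h3]
      exact (isEntireSeq_besselSeq 1 (x ^ 2)).hasSum.mul_left _
    · simp only [h2, integral_cos_pow_odd, mul_zero]
      exact hasSum_zero
  rw [besselI0, h1.unique h4, add_zero, inv_mul_cancel_left₀ Real.pi_ne_zero]

theorem besselI0_sqrt_mul {u : ℝ} (hu : 0 ≤ u) (t : ℝ) :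
    besselI0 (Real.sqrt u * t) = seriesSum (besselSeq u) (t ^ 2) := by
  rw [besselI0_eq_seriesSum, mul_pow, Real.sq_sqrt hu]
  exact tsum_congr fun n => by simp only [besselSeq]; ring

/-- The function `I₀(√u t)` is symmetric in `u` and `t ^ 2`. -/
theorem seriesSum_besselSeq_comm (u x : ℝ) :
    seriesSum (besselSeq u) x = seriesSum (besselSeq x) u :=
  tsum_congr fun n => by simp only [besselSeq]; ring

/-- Differential operators in `u` act on `I₀(√u t)` through the coefficients of the power series in
`t ^ 2`. -/
theorem polyDiffOp_besselI0 {m : ℕ} (l : Fin (m + 1) → ℤ[X]) {u : ℝ} (hu : 0 < u) (t : ℝ) :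
    IsEntireSeq (fun n => (∑ j : Fin (m + 1),
      aeval u (l j) * ((u ^ (j : ℕ))⁻¹ * n.descFactorial j)) * besselSeq u n) ∧
    polyDiffOp l (fun v : ℝ => besselI0 (Real.sqrt v * t)) u =
      seriesSum (fun n => (∑ j : Fin (m + 1),
        aeval u (l j) * ((u ^ (j : ℕ))⁻¹ * n.descFactorial j)) * besselSeq u n) (t ^ 2) := by
  have h0 : (fun v : ℝ => besselI0 (Real.sqrt v * t)) =ᶠ[nhds u] seriesSum (besselSeq (t ^ 2)) := by
    filter_upwards [lt_mem_nhds hu] with v hv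
    rw [besselI0_sqrt_mul hv.le, seriesSum_besselSeq_comm]
  have h1 : ∀ x n, ∀ j : Fin (m + 1), aeval u (l j) * ((u ^ (j : ℕ))⁻¹ * n.descFactorial j) *
      besselSeq u n * x ^ n = aeval u (l j) * (u ^ (j : ℕ))⁻¹ *
        ((n.descFactorial j : ℝ) * besselSeq x n * u ^ n) := fun x n j => by
    simp only [besselSeq]; ring
  have h2 : ∀ x, ∀ j : Fin (m + 1), Summable fun n : ℕ => aeval u (l j) * (u ^ (j : ℕ))⁻¹ *
        ((n.descFactorial j : ℝ) * besselSeq x n * u ^ n) := fun x j =>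
    (pow_mul_iteratedDeriv_seriesSum (isEntireSeq_besselSeq x) j u).1.mul_left _
  constructor
  · intro x
    simp only [Finset.sum_mul, h1]
    exact summable_sum fun j _ => h2 x j
  · simp only [seriesSum, Finset.sum_mul, h1]
    rw [Summable.tsum_finsetSum fun j _ => h2 (t ^ 2) j, polyDiffOp]
    refine Finset.sum_congr rfl fun j _ => ?_
    have h3 := (pow_mul_iteratedDeriv_seriesSum (isEntireSeq_besselSeq (t ^ 2)) j u).2
    rw [tsum_mul_left, smul_eq_mul, h0.iteratedDeriv_eq, mul_assoc]
    rw [seriesSum] at h3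
    rw [← h3, inv_mul_cancel_left₀ (pow_ne_zero _ hu.ne')]

/-! ### The adjoints of the Bessel-power operators on power series -/

/-- The operator `besselPowOpAdj N k`, conjugated by the factor `t`, on the coefficients of even
power series in `t`. -/
def besselSeqOp (N : ℕ) : ℕ → (ℕ → ℝ) → (ℕ → ℝ)
  | 0, b => b
  | 1, b => fun n => -2 * (n * b n)
  | k + 2, b => fun n => besselSeqOp N (k + 1) (fun i => -2 * (i * b i)) n -
      ((k : ℝ) + 1) * ((N : ℝ) - (k : ℝ)) * besselSeqOp N k (shiftSeq b) n

theorem IsEntireSeq.besselSeqOp (N k : ℕ) {b : ℕ → ℝ} (hb : IsEntireSeq b) :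
    IsEntireSeq (besselSeqOp N k b) := by
  induction k using Nat.twoStepInduction generalizing b with
  | zero => exact hb
  | one => exact hb.natCast_mul.const_mul _
  | more k ih1 ih2 => exact (ih2 (hb.natCast_mul.const_mul _)).sub ((ih1 hb.shift).const_mul _)

theorem neg_deriv_mul_congr {g h : ℝ → ℝ} (hgh : ∀ s, 0 < s → g s = h s) (s : ℝ) (hs : 0 < s) :
    -deriv (fun r => r * g r) s = -deriv (fun r => r * h r) s := by
  have : (fun r => r * g r) =ᶠ[nhds s] fun r => r * h r := by
    filter_upwards [lt_mem_nhds hs] with r hr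
    rw [hgh r hr]
  rw [this.deriv_eq]

/-- The operators are local: on `t > 0` they only see the values of the function there. -/
theorem besselPowOpAdj_congr (N k : ℕ) {g h : ℝ → ℝ} (hgh : ∀ s, 0 < s → g s = h s) (t : ℝ)
    (ht : 0 < t) : besselPowOpAdj N k g t = besselPowOpAdj N k h t := by
  induction k using Nat.twoStepInduction generalizing g h with
  | zero => exact hgh t ht
  | one => exact neg_deriv_mul_congr hgh t ht
  | more k ih1 ih2 =>
    have h1 := ih2 (neg_deriv_mul_congr hgh)
    have h2 := ih1 (g := fun s => s ^ 2 * g s) (h := fun s => s ^ 2 * h s)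
      fun s hs => by rw [hgh s hs]
    simp only [besselPowOpAdj, h1, h2]

theorem neg_deriv_mul_seriesSum_div {b : ℕ → ℝ} (hb : IsEntireSeq b) {s : ℝ} (hs : 0 < s) :
    -deriv (fun r => r * (seriesSum b (r ^ 2) / r)) s =
      seriesSum (fun n => -2 * (n * b n)) (s ^ 2) / s := by
  have h : (fun r => r * (seriesSum b (r ^ 2) / r)) =ᶠ[nhds s] fun r => seriesSum b (r ^ 2) := by
    filter_upwards [lt_mem_nhds hs] with r hr
    rw [mul_div_cancel₀ _ hr.ne']
  have h2 := (hasDerivAt_seriesSum hb (s ^ 2)).comp s (hasDerivAt_pow 2 s)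
  have h3 : deriv (fun r => seriesSum b (r ^ 2)) s = _ := h2.deriv
  rw [h.deriv_eq, h3, seriesSum_const_mul, ← mul_seriesSum_derivSeq hb]
  field_simp
  push_cast
  ring

theorem besselPowOpAdj_seriesSum (N k : ℕ) {b : ℕ → ℝ} (hb : IsEntireSeq b) {t : ℝ} (ht : 0 < t) :
    besselPowOpAdj N k (fun s => seriesSum b (s ^ 2) / s) t =
      seriesSum (besselSeqOp N k b) (t ^ 2) / t := by
  induction k using Nat.twoStepInduction generalizing b with
  | zero => rfl
  | one => exact neg_deriv_mul_seriesSum_div hb ht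
  | more k ih1 ih2 =>
    have hb1 : IsEntireSeq fun n => -2 * (n * b n) := hb.natCast_mul.const_mul _
    simp only [besselPowOpAdj]
    rw [besselPowOpAdj_congr N (k + 1) (fun s hs => neg_deriv_mul_seriesSum_div hb hs) t ht, ih2 hb1,
      besselPowOpAdj_congr N k (h := fun s => seriesSum (shiftSeq b) (s ^ 2) / s)
        (fun s hs => by rw [seriesSum_shiftSeq hb, mul_div_assoc]) t ht, ih1 hb.shift, besselSeqOp,
      seriesSum_sub (hb1.besselSeqOp N (k + 1)) ((hb.shift.besselSeqOp N k).const_mul _),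
      seriesSum_const_mul]
    ring

/-- The operators in closed form: the factors `-θ` and the factors `t ^ 2` are the single and the
double steps of a descent. -/
theorem besselSeqOp_eq_sum (m k : ℕ) (b : ℕ → ℝ) (n : ℕ) : besselSeqOp (m + 1) k b n =
    ∑ p ∈ Finset.HasAntidiagonal.antidiagonal n,
      descentSum (verrillWeight ℝ m) k p.1 (fun i => 2 * (-(p.2 : ℝ) - i)) * b p.2 := by
  induction k using Nat.twoStepInduction generalizing b n with
  | zero =>
    cases n with
    | zero => simp [besselSeqOp, descentSum]
    | succ n => simp [besselSeqOp, descentSum, Finset.Nat.sum_antidiagonal_succ]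
  | one =>
    cases n with
    | zero => simp [besselSeqOp, descentSum]
    | succ n =>
      simp [besselSeqOp, descentSum, Finset.Nat.sum_antidiagonal_succ]
      ring
  | more k ih1 ih2 =>
    simp only [besselSeqOp, ih1, ih2]
    have hw : verrillWeight ℝ m (k + 1) = -(((k : ℝ) + 1) * (((m + 1 : ℕ) : ℝ) - (k : ℝ))) := by
      rw [verrillWeight]; push_cast; ring
    cases n with
    | zero => simp [shiftSeq, descentSum_zero_right]
    | succ n =>
      have h1 : ∑ p ∈ Finset.HasAntidiagonal.antidiagonal (n + 1), descentSum (verrillWeight ℝ m) k p.1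
            (fun i => 2 * (-(p.2 : ℝ) - i)) * shiftSeq b p.2 =
          ∑ p ∈ Finset.HasAntidiagonal.antidiagonal n, descentSum (verrillWeight ℝ m) k p.1
            (fun i => 2 * (-(p.2 : ℝ) - (i + 1 : ℕ))) * b p.2 := by
        rw [Finset.Nat.sum_antidiagonal_succ']
        simp only [shiftSeq, mul_zero, zero_add]
        refine Finset.sum_congr rfl fun p _ => ?_
        congr 2
        ext i
        push_cast; ring
      rw [h1, Finset.Nat.sum_antidiagonal_succ, Finset.Nat.sum_antidiagonal_succ]
      simp only [descentSum, hw, add_mul, Finset.sum_add_distrib]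
      have h2 : ∀ q : ℕ × ℕ → ℝ, ∀ c : ℝ, ∑ p ∈ Finset.HasAntidiagonal.antidiagonal n, -c * q p * b p.2 =
          -(c * ∑ p ∈ Finset.HasAntidiagonal.antidiagonal n, q p * b p.2) := fun q c => by
        rw [Finset.mul_sum, ← Finset.sum_neg_distrib]
        exact Finset.sum_congr rfl fun _ _ => by ring
      rw [h2, sub_eq_add_neg, ← add_assoc]
      congr 2
      · push_cast; ring
      · exact Finset.sum_congr rfl fun _ _ => by push_cast; ring
      · ring

/-! ### Vanhove's operator -/

theorem prod_Icc_neg_sub_sq (p k : ℕ) : (∏ i ∈ Finset.Icc 1 k, (-(p : ℝ) - i) ^ 2) *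
    (p.factorial : ℝ) ^ 2 = ((p + k).factorial : ℝ) ^ 2 := by
  induction k with
  | zero => simp
  | succ k ih =>
    rw [Finset.prod_Icc_succ_top (by omega), ← add_assoc, Nat.factorial_succ, Nat.cast_mul, mul_pow,
      ← ih]
    push_cast; ring

theorem eval_verrillPoly_neg (m k p : ℕ) :
    (((verrillPoly m (k + 1)).eval (-(p : ℤ)) : ℤ) : ℝ) =
      descentSum (verrillWeight ℝ m) (m + 2) (k + 1) (fun n => -(p : ℝ) - n) *
        ∏ i ∈ Finset.Icc 1 k, (-(p : ℝ) - i) ^ 2 := by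
  rw [eval_verrillPoly, ← eq_intCast (Int.castRingHom ℝ), map_mul, map_descentSum, map_prod]
  simp only [map_verrillWeight]
  simp

/-- The two sides of the transfer identity agree term by term: the squares in the Verrill sums are
exactly the quotients of the coefficients of `I₀`. -/
theorem descentSum_mul_besselSeq (m n k : ℕ) (hk : k ≤ n + 1) {u : ℝ} (hu : u ≠ 0) :
    descentSum (verrillWeight ℝ m) (m + 2) k (fun i => 2 * (-((n + 1 - k : ℕ) : ℝ) - i)) *
        besselSeq u (n + 1 - k) =
      2 ^ m * (u ^ (1 - (k : ℤ)) * ((verrillPoly m k).eval ((k : ℤ) - n - 1) : ℤ)) *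
        besselSeq u n := by
  cases k with
  | zero =>
    have h1 : (n.factorial : ℝ) ≠ 0 := by exact_mod_cast n.factorial_ne_zero
    have h2 : (n : ℝ) + 1 ≠ 0 := by positivity
    have h3 : (((verrillPoly m 0).eval (((0 : ℕ) : ℤ) - n - 1) : ℤ) : ℝ) = (-((n : ℝ) + 1)) ^ m := by
      simp [verrillPoly]; ring
    rw [h3, descentSum_zero_right]
    simp only [besselSeq, Nat.sub_zero, Nat.factorial_succ, Nat.cast_zero, sub_zero, zpow_one]
    push_cast
    rw [mul_pow]
    field_simp
    ring
  | succ k =>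
    obtain ⟨p, rfl⟩ : ∃ p, n = p + k := ⟨n - k, by omega⟩
    have h1 : (p.factorial : ℝ) ≠ 0 := by exact_mod_cast p.factorial_ne_zero
    have h2 : ((p + k).factorial : ℝ) ≠ 0 := by exact_mod_cast (p + k).factorial_ne_zero
    have h3 := prod_Icc_neg_sub_sq p k
    have h4 := descentSum_smul (verrillWeight ℝ m) 2 (m + 2) (k + 1) (fun i => -(p : ℝ) - i)
    have h5 := eval_verrillPoly_neg m k p
    have h6 : u ^ (1 - ((k + 1 : ℕ) : ℤ)) = (u ^ k)⁻¹ := by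
      rw [← zpow_natCast, ← zpow_neg]; congr 1; push_cast; ring
    rw [show p + k + 1 - (k + 1) = p by omega,
      show ((k + 1 : ℕ) : ℤ) - ((p + k : ℕ) : ℤ) - 1 = -(p : ℤ) by push_cast; ring, h6, h5]
    set D := descentSum (verrillWeight ℝ m) (m + 2) (k + 1) fun n => -(p : ℝ) - n
    set D' := descentSum (verrillWeight ℝ m) (m + 2) (k + 1) fun i => 2 * (-(p : ℝ) - i)
    have h7 : D' * 4 ^ k = 2 ^ m * D := by
      have : (2 : ℝ) ^ (2 * (k + 1)) = 4 * 4 ^ k := by rw [pow_mul, pow_succ']; norm_num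
      rw [this] at h4
      linear_combination h4 / 4
    simp only [besselSeq, ← h3]
    have h8 : (∏ i ∈ Finset.Icc 1 k, (-(p : ℝ) - i) ^ 2) ≠ 0 := by
      intro h; rw [h, zero_mul] at h3; exact pow_ne_zero 2 h2 h3.symm
    rw [pow_add, div_pow u 4 k]
    field_simp
    linear_combination h7

theorem besselSeqOp_besselSeq (m n : ℕ) {u : ℝ} (hu : u ≠ 0) :
    besselSeqOp (m + 1) (m + 2) (besselSeq u) (n + 1) =
      2 ^ m * (∑ k ∈ Finset.range (m / 2 + 2),
        u ^ (1 - (k : ℤ)) * ((verrillPoly m k).eval ((k : ℤ) - n - 1) : ℤ)) * besselSeq u n := by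
  rw [besselSeqOp_eq_sum, Finset.Nat.sum_antidiagonal_eq_sum_range_succ
    (fun i j => descentSum (verrillWeight ℝ m) (m + 2) i (fun k => 2 * (-(j : ℝ) - k)) *
      besselSeq u j), Finset.mul_sum, Finset.sum_mul]
  -- The terms with `m / 2 + 1 < k` vanish on the left, those with `n + 1 < k` on the right.
  have hl : Finset.range (min (n + 2) (m / 2 + 2)) ⊆ Finset.range (n + 1).succ :=
    Finset.range_mono (min_le_left _ _)
  have hr : Finset.range (min (n + 2) (m / 2 + 2)) ⊆ Finset.range (m / 2 + 2) :=
    Finset.range_mono (min_le_right _ _)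
  rw [← Finset.sum_subset hl, ← Finset.sum_subset hr]
  · refine Finset.sum_congr rfl fun k hk => ?_
    have := Finset.mem_range.1 hk
    exact descentSum_mul_besselSeq m n k (by omega) hu
  · intro k hk hk'
    rw [Finset.mem_range] at hk hk'
    rw [← eval_verrillShift, eval_verrillShift_eq_zero m k n (by omega)]
    simp
  · intro k hk hk'
    rw [Finset.mem_range] at hk hk'
    rw [descentSum_eq_zero _ _ _ _ (by omega), zero_mul]

theorem besselSeqOp_zero (m : ℕ) (b : ℕ → ℝ) : besselSeqOp (m + 1) (m + 2) b 0 = 0 := by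
  simp [besselSeqOp_eq_sum, descentSum_zero_right]

theorem isVanhoveOperator_vanhoveCoeff (m : ℕ) : IsVanhoveOperator m (vanhoveCoeff m) := by
  refine ⟨vanhoveCoeff_last m, (-2) ^ m, by simp, fun u hu t ht => ?_⟩
  obtain ⟨h1, h2⟩ := polyDiffOp_besselI0 (vanhoveCoeff m) hu t
  have h3 : (fun s => besselI0 (Real.sqrt u * s) / s) =
      fun s => seriesSum (besselSeq u) (s ^ 2) / s := funext fun s => by
    rw [besselI0_sqrt_mul hu.le]
  rw [h2, h3, besselPowOpAdj_seriesSum _ _ (isEntireSeq_besselSeq u) ht, eq_div_iff ht.ne']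
  set δ : ℕ → ℝ := fun n => (∑ j : Fin (m + 1),
    aeval u (vanhoveCoeff m j) * ((u ^ (j : ℕ))⁻¹ * n.descFactorial j)) * besselSeq u n
  calc (-2) ^ m * (t * seriesSum δ (t ^ 2)) * t
      = seriesSum (shiftSeq fun n => (-2) ^ m * δ n) (t ^ 2) := by
        rw [seriesSum_shiftSeq (h1.const_mul _), seriesSum_const_mul]; ring
    _ = _ := by
        congr 1
        ext n
        cases n with
        | zero => rw [besselSeqOp_zero]; rfl
        | succ n =>
          simp only [shiftSeq, δ]
          rw [besselSeqOp_besselSeq m n hu.ne', sum_vanhoveCoeff_descFactorial m n u hu.ne',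
            ← mul_assoc, ← mul_assoc, ← mul_pow]
          norm_num

theorem besselSeq_ne_zero {u : ℝ} (hu : u ≠ 0) (n : ℕ) : besselSeq u n ≠ 0 :=
  div_ne_zero (pow_ne_zero _ (div_ne_zero hu four_ne_zero))
    (pow_ne_zero _ (by exact_mod_cast n.factorial_ne_zero))

/-- A differential operator of order `m` is determined by its values on the functions
`u ↦ I₀(√u t)`, because these have linearly independent derivatives up to the order `m`. -/
theorem aeval_eq_of_polyDiffOp_besselI0 {m : ℕ} (l l' : Fin (m + 1) → ℤ[X]) (c c' : ℝ) {u : ℝ}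
    (hu : 0 < u) (h : ∀ t : ℝ, 0 < t →
      c * (t * polyDiffOp l (fun v : ℝ => besselI0 (Real.sqrt v * t)) u) =
        c' * (t * polyDiffOp l' (fun v : ℝ => besselI0 (Real.sqrt v * t)) u)) (j : Fin (m + 1)) :
    c * aeval u (l j) = c' * aeval u (l' j) := by
  have h1 := (polyDiffOp_besselI0 l hu 0).1.const_mul c
  have h2 := (polyDiffOp_besselI0 l' hu 0).1.const_mul c'
  have h3 := eq_zero_of_seriesSum_eq_zero (h1.sub h2) fun x hx => by
    have ht := Real.sqrt_pos.2 hx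
    have h4 := h _ ht
    rw [(polyDiffOp_besselI0 l hu _).2, (polyDiffOp_besselI0 l' hu _).2, Real.sq_sqrt hx.le,
      mul_left_comm, mul_left_comm c'] at h4
    rw [seriesSum_sub h1 h2, seriesSum_const_mul, seriesSum_const_mul,
      mul_left_cancel₀ ht.ne' h4, sub_self]
  have h5 := eq_zero_of_sum_descFactorial (m := m) (r := m + 1)
    (fun i => if hi : i < m + 1 then
      (c * aeval u (l ⟨i, hi⟩) - c' * aeval u (l' ⟨i, hi⟩)) * (u ^ i)⁻¹ else 0)
    (fun n _ => by
      rw [Finset.sum_range]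
      have h6 := h3 n
      rw [← mul_assoc, ← mul_assoc, ← sub_mul] at h6
      rw [← (mul_eq_zero.1 h6).resolve_right (besselSeq_ne_zero hu.ne' n), Finset.mul_sum,
        Finset.mul_sum, ← Finset.sum_sub_distrib]
      refine Finset.sum_congr rfl fun i _ => ?_
      rw [dif_pos i.2]
      ring) j j.2 (by omega)
  rw [dif_pos j.2] at h5
  exact sub_eq_zero.1
    ((mul_eq_zero.1 h5).resolve_right (inv_ne_zero (pow_ne_zero _ hu.ne')))

theorem IsVanhoveOperator.unique {m : ℕ} {l l' : Fin (m + 1) → ℤ[X]} (h : IsVanhoveOperator m l)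
    (h' : IsVanhoveOperator m l') : l = l' := by
  obtain ⟨hl, c, hc, h⟩ := h
  obtain ⟨hl', c', hc', h'⟩ := h'
  have h1 : ∀ j, C c * (l j).map (Int.castRingHom ℝ) = C c' * (l' j).map (Int.castRingHom ℝ) := by
    intro j
    refine eq_of_infinite_eval_eq _ _ ((Set.Ioi_infinite (0 : ℝ)).mono fun u hu => ?_)
    have := aeval_eq_of_polyDiffOp_besselI0 l l' c c' hu
      (fun t ht => (h u hu t ht).trans (h' u hu t ht).symm) j
    simpa [aeval_def, eval_map] using this
  have hmonic : ((l (Fin.last m)).map (Int.castRingHom ℝ)).Monic := by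
    rw [hl]
    exact (((monic_X_pow _).mul (monic_prod_of_monic _ _ fun n _ => monic_X_sub_C _))).map _
  -- The two operators have the same monic leading coefficient, which fixes the constant.
  have hcc : c = c' := by
    have h2 := h1 (Fin.last m)
    rw [hl', ← hl] at h2
    exact C_injective (mul_right_cancel₀ hmonic.ne_zero h2)
  funext j
  have h2 := h1 j
  rw [← hcc] at h2
  exact map_injective _ Int.cast_injective (mul_left_cancel₀ (C_ne_zero.2 hc) h2)

theorem proposition2p1 {𝕜 E : Type*} [RCLike 𝕜] [NormedAddCommGroup E] [NormedSpace 𝕜 E]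
    (m : ℕ) (hm : 0 < m) :
    -- Verrill's polynomials: normalization, and equality of the two expressions
    (verrillPoly m 0 = X ^ m ∧
      ∀ k : ℕ, 0 < k →
        algebraMap ℚ[X] (RatFunc ℚ) ((verrillPoly m k).map (Int.castRingHom ℚ)) =
          verrillRat m k) ∧
    -- Vanhove's operator of order `m` exists and is unique
    (∃! l : Fin (m + 1) → ℤ[X], IsVanhoveOperator m l) ∧
    -- the explicit representation of Vanhove's operator
    ∀ l : Fin (m + 1) → ℤ[X], IsVanhoveOperator m l →
      ∀ (f : 𝕜 → E) (u : 𝕜), u ≠ 0 → ContDiffAt 𝕜 m f u →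
        polyDiffOp l f u =
          (-1 : 𝕜) ^ m • ∑ k ∈ Finset.range (m / 2 + 2),
            u ^ (1 - (k : ℤ)) •
              polyThetaHat ((verrillPoly m k).comp (C (k : ℤ) - X)) f u := by
  refine ⟨⟨by simp [verrillPoly], verrillPoly_eq_verrillRat m⟩,
    ⟨vanhoveCoeff m, isVanhoveOperator_vanhoveCoeff m,
      fun l hl => hl.unique (isVanhoveOperator_vanhoveCoeff m)⟩, fun l hl f u hu hf => ?_⟩
  rw [hl.unique (isVanhoveOperator_vanhoveCoeff m)]
  exact polyDiffOp_vanhoveCoeff m f u hu hf
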